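/- **Contextual dynamic pricing.** Fix constants $\bar\gamma,\bar X,b,\underline\lambda,C>0$ and $0<\underline a\le\bar a$, and put $\mathcal A=[\underline a,\bar a]$. Let $d\ge1$ be the context dimension and $T\ge1$ the horizon. *Setting.* The contexts $X_t$ are i.i.d. with values in a set $\mathcal X\subset\{x\in\mathbb R^d:\|x\|_2\le\bar X\}$ and $\mathbb E[X_tX_t^\top]\succeq\underline\lambda I$ (which holds in particular if the smallest eigenvalue of the covariance matrix is at least $\underline\lambda$). The law of the contexts does not depend on the environment. The environments are $\gamma=(\alpha,\beta)\in\Gamma\subset\mathbb R^{2d}$, where $\Gamma$ is a convex set of positive Lebesgue measure with $\|\gamma\|_2\le\bar\gamma$ for all $\gamma\in\Gamma$, and $\beta^\top x\le-b$ for all $\gamma\in\Gamma$, $x\in\mathcal X$. The prior $\mathcal P_\gamma$ is the uniform distribution on $\Gamma$. In environment $\gamma$, when the price $a_t$ is posted, the demand is $D_t=\alpha^\top X_t+\beta^\top X_t\cdot a_t+\epsilon_t$ with $\epsilon_t$ i.i.d. $\mathcal N(0,1)$, and the expected revenue is $r(x,a;\gamma)=a(\alpha^\top x+\beta^\top x\cdot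 a)$. Let $a^*_\gamma(x)=\arg\max_{a\in\mathcal A}r(x,a;\gamma)$, let $H_t=(X_1,a_1,D_1,\dots,X_{t-1},a_{t-1},D_{t-1},X_t)$, let $\mathcal P(\cdot\mid H_t)$ be the posterior distribution of the environment, and let $\mathrm{Alg}^*(H_t)=\int a^*_{\gamma'}(X_t)\,\mathcal P(d\gamma'\mid H_t)$ (posterior averaging). The posted price is $a_t=\mathrm{TF}(H_t)=\mathrm{Alg}^*(H_t)+\Delta_t$, where $\Delta_t=\pm CT^{-1/4}$ with probability $1/2$ each. The variables $X_t,\epsilon_t,\Delta_t$, $t=1,\dots,T$, are mutually independent. Posted prices lie in $\mathcal A_T=[\underline a-CT^{-1/4},\bar a+CT^{-1/4}]$. The regret in environment $\gamma$ is $\mathrm{Regret}(\mathrm{TF};\gamma)=\mathbb E\big[\sum_{t=1}^T r(X_t,a^*_\gamma(X_t);\gamma)-r(X_t,a_t;\gamma)\big]$. *Claim.* There are constants $\bar r$ and $C_\Gamma,C_r,K>0$, depending only on $\bar\gamma,\bar X,\underline a,\bar a,b,\underline\lambda,C$, such that for all $d,T,\mathcal X,\Gamma$ and context laws as above, with $Z=(x,a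 x)\in\mathbb R^{2d}$, $\Delta(x,a)=\frac12ZZ^\top$ and $\|z\|_{\Delta(x,a)}=\sqrt{z^\top\Delta(x,a)z}$: 1. (Environment space.) $\|\gamma\|_2\le\bar\gamma$ and $r(x,a;\gamma)\le\bar r$ for all $\gamma\in\Gamma$, $x\in\mathcal X$, $a\in\mathcal A_T$, and the prior is uniform on $\Gamma$. 2. (Observation distribution.) Let $\mathbb P_\gamma(\cdot\mid x,a)=\mathcal N(\alpha^\top x+\beta^\top x\cdot a,1)$. For all $x\in\mathcal X$, $a\in\mathcal A_T$, $\gamma,\gamma'\in\Gamma$: $\mathrm{KL}(\mathbb P_\gamma(\cdot|x,a)\,\|\,\mathbb P_{\gamma'}(\cdot|x,a))\ge\|\gamma-\gamma'\|^2_{\Delta(x,a)}$; for $D\sim\mathbb P_\gamma(\cdot|x,a)$ the centred log-likelihood ratio of $\gamma$ against $\gamma'$ is sub-Gaussian with parameter $\sqrt2\,\|\gamma-\gamma'\|_{\Delta(x,a)}$; and for every $D\in\mathbb R$ the map $\gamma'\mapsto\log\mathbb P_{\gamma'}(D|x,a)$ is concave on $\Gamma$ and twice continuously differentiable with $\|\nabla^2_{\gamma'}\log\mathbb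 P_{\gamma'}(D|x,a)\|_2^2\le C_\Gamma$. 3. (Reward gaps.) For every $\gamma\in\Gamma$ and every possible history $H_t$, $$\mathbb E\big[r(X_t,\mathrm{Alg}^*(H_t);\gamma)-r(X_t,\mathrm{TF}(H_t);\gamma)\mid H_t\big]\le\frac{\bar X\bar\gamma C^2}{\sqrt T},$$ $$r(X_t,a^*_\gamma(X_t);\gamma)-r(X_t,\mathrm{Alg}^*(H_t);\gamma)\le C_r\int\|\gamma-\gamma'\|_2^2\,\mathcal P(d\gamma'\mid H_t).$$ 4. (Regret.) For every $\gamma\in\Gamma$ the regret is well defined (the realized regret is integrable) and $$\mathrm{Regret}(\mathrm{TF};\gamma)\le K\,d\,\sqrt T\,(1+\log T)^2,$$ that is, $\mathrm{Regret}(\mathrm{TF};\gamma)=O(d\sqrt T)$ up to logarithmic factors, uniformly over $\gamma\in\Gamma$. -/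

import Mathlib

open MeasureTheory ProbabilityTheory Set
open scoped ENNReal NNReal Matrix

noncomputable section

namespace ContextualPricing

/-- Context vectors, with the Euclidean norm. -/
abbrev Ctx (d : ℕ) := EuclideanSpace ℝ (Fin d)

/-- Environment parameters `γ = (α, β)` in `ℝ^{2d}`, with the Euclidean norm. -/
abbrev Env (d : ℕ) := EuclideanSpace ℝ (Fin d ⊕ Fin d)

variable {d : ℕ}

/-- The component `α` of `γ = (α, β)`. -/
def interceptPart (γ : Env d) : Ctx d := WithLp.toLp 2 fun i => γ (Sum.inl i)

/-- The component `β` of `γ = (α, β)`. -/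
def slopePart (γ : Env d) : Ctx d := WithLp.toLp 2 fun i => γ (Sum.inr i)

/-- The mean demand `αᵀx + βᵀx · a` at context `x` and price `a`. -/
def meanDemand (γ : Env d) (x : Ctx d) (a : ℝ) : ℝ :=
  inner ℝ (interceptPart γ) x + inner ℝ (slopePart γ) x * a

/-- The conditional law of the demand given context `x` and price `a`. The revenue, being
`price * demand`, carries no further information. -/
def demandLaw (γ : Env d) (x : Ctx d) (a : ℝ) : Measure ℝ :=
  gaussianReal (meanDemand γ x a) 1

/-- The Lebesgue density of `demandLaw γ x a`. -/
def demandDensity (γ : Env d) (x : Ctx d) (a D : ℝ) : ℝ :=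
  gaussianPDFReal (meanDemand γ x a) 1 D

/-- The expected revenue `r(x, a; γ)`. -/
def expectedRevenue (γ : Env d) (x : Ctx d) (a : ℝ) : ℝ := meanDemand γ x a * a

theorem expectedRevenue_eq_integral (γ : Env d) (x : Ctx d) (a : ℝ) :
    expectedRevenue γ x a = ∫ D, D * a ∂(demandLaw γ x a) := by
  rw [integral_mul_const, demandLaw, integral_id_gaussianReal, expectedRevenue]

/-- The optimal price in `[lo, hi]` for environment `γ` and context `x` (the largest one, should
there be several). -/
def optPrice (lo hi : ℝ) (γ : Env d) (x : Ctx d) : ℝ :=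
  sSup {a | a ∈ Icc lo hi ∧ IsMaxOn (expectedRevenue γ x) (Icc lo hi) a}

theorem optPrice_spec {lo hi : ℝ} (h : lo ≤ hi) (γ : Env d) (x : Ctx d) :
    optPrice lo hi γ x ∈ Icc lo hi ∧
      IsMaxOn (expectedRevenue γ x) (Icc lo hi) (optPrice lo hi γ x) := by
  have hc : Continuous (expectedRevenue γ x) := by
    unfold expectedRevenue meanDemand; fun_prop
  obtain ⟨a, ha, hmax⟩ := isCompact_Icc.exists_isMaxOn (nonempty_Icc.2 h) hc.continuousOn
  have hset : {a | a ∈ Icc lo hi ∧ IsMaxOn (expectedRevenue γ x) (Icc lo hi) a}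
      = Icc lo hi ∩ (expectedRevenue γ x) ⁻¹' (Ici (expectedRevenue γ x a)) := by
    ext b
    constructor
    · rintro ⟨hb, hbm⟩
      exact ⟨hb, hbm ha⟩
    · rintro ⟨hb, hbm⟩
      refine ⟨hb, fun c hcI => ?_⟩
      have h1 : expectedRevenue γ x c ≤ expectedRevenue γ x a := hmax hcI
      exact h1.trans hbm
  have hcomp : IsCompact {a | a ∈ Icc lo hi ∧ IsMaxOn (expectedRevenue γ x) (Icc lo hi) a} := by
    rw [hset]
    exact isCompact_Icc.inter_right (isClosed_Ici.preimage hc)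
  exact hcomp.sSup_mem ⟨a, ha, hmax⟩

/-- The uniform distribution over `Γ`. -/
def uniformPrior (Γ : Set (Env d)) : Measure (Env d) := ProbabilityTheory.cond volume Γ

/-- One completed period: context, posted price, observed demand. -/
abbrev Record (d : ℕ) := Ctx d × ℝ × ℝ

/-- The likelihood of the completed periods `h`, as a function of the environment. The law of the
contexts does not depend on the environment, so that its factor is common to all environments. -/
def likelihood (h : List (Record d)) (γ : Env d) : ℝ :=
  (h.map fun z => demandDensity γ z.1 z.2.1 z.2.2).prod

/-- The posterior distribution of the environment given the completed periods `h` (by Bayes' rule).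
The current context adds nothing, as its law does not depend on the environment. -/
def posterior (π : Measure (Env d)) (h : List (Record d)) : Measure (Env d) :=
  (∫⁻ γ, ENNReal.ofReal (likelihood h γ) ∂π)⁻¹ •
    π.withDensity fun γ => ENNReal.ofReal (likelihood h γ)

/-- Posterior averaging: the posterior mean of the optimal price at the current context `x`. -/
def algStar (lo hi : ℝ) (π : Measure (Env d)) (h : List (Record d)) (x : Ctx d) : ℝ :=
  ∫ γ, optPrice lo hi γ x ∂(posterior π h)

/-- The size `C T^{-1/4}` of the perturbations. -/
def perturbationSize (C : ℝ) (T : ℕ) : ℝ := C * (T : ℝ) ^ (-(1 / 4) : ℝ)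

/-- The law of a perturbation: `± C T^{-1/4}` with probability `1/2` each. -/
def perturbationLaw (C : ℝ) (T : ℕ) : Measure ℝ :=
  (2⁻¹ : ℝ≥0∞) • Measure.dirac (perturbationSize C T) +
    (2⁻¹ : ℝ≥0∞) • Measure.dirac (-perturbationSize C T)

/-- The conditional law, given the history, of the price posted by the perturbed algorithm. -/
def tfLaw (lo hi : ℝ) (π : Measure (Env d)) (C : ℝ) (T : ℕ)
    (h : List (Record d)) (x : Ctx d) : Measure ℝ :=
  (perturbationLaw C T).map fun δ => algStar lo hi π h x + δ

/-- The completed periods before period `n` (periods are numbered from `0`) when the environment is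
`γ`, the contexts are `x`, the demand noises are `e`, and the price posted in each period is the
output of `alg` plus the perturbation `δ`. -/
def past (alg : List (Record d) → Ctx d → ℝ) (γ : Env d)
    (x : ℕ → Ctx d) (e δ : ℕ → ℝ) : ℕ → List (Record d)
  | 0 => []
  | n + 1 =>
      past alg γ x e δ n ++
        [(x n, alg (past alg γ x e δ n) (x n) + δ n,
          meanDemand γ (x n) (alg (past alg γ x e δ n) (x n) + δ n) + e n)]

/-- The price posted in period `n`. -/
def postedPrice (alg : List (Record d) → Ctx d → ℝ) (γ : Env d)
    (x : ℕ → Ctx d) (e δ : ℕ → ℝ) (n : ℕ) : ℝ :=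
  alg (past alg γ x e δ n) (x n) + δ n

/-- The contexts `X`, demand noises `ε` and perturbations `δ` are mutually independent, the contexts
with law `PX`, the noises standard normal, the perturbations with law `perturbationLaw C T`. -/
structure IsDrivingNoise {Ω : Type*} [MeasurableSpace Ω] (μ : Measure Ω) (PX : Measure (Ctx d))
    (C : ℝ) (T : ℕ) (X : ℕ → Ω → Ctx d) (ε δ : ℕ → Ω → ℝ) : Prop where
  measurable_X : ∀ n, Measurable (X n)
  measurable_ε : ∀ n, Measurable (ε n)
  measurable_δ : ∀ n, Measurable (δ n)
  law : ∀ n, μ.map (fun ω => (X n ω, ε n ω, δ n ω)) =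
    PX.prod ((gaussianReal 0 1).prod (perturbationLaw C T))
  indep : iIndepFun (fun n ω => (X n ω, ε n ω, δ n ω)) μ

/-- The realized regret over `T` periods of the perturbed algorithm in environment `γ`, against the
optimal prices in `[lo, hi]`. -/
def realizedRegret (lo hi : ℝ) (alg : List (Record d) → Ctx d → ℝ) (γ : Env d) (T : ℕ)
    (x : ℕ → Ctx d) (e δ : ℕ → ℝ) : ℝ :=
  ∑ n ∈ Finset.range T,
    (expectedRevenue γ (x n) (optPrice lo hi γ (x n)) -
      expectedRevenue γ (x n) (postedPrice alg γ x e δ n))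

/-- The regret: the expectation of the realized regret. -/
def regret {Ω : Type*} [MeasurableSpace Ω] (μ : Measure Ω) (lo hi : ℝ)
    (alg : List (Record d) → Ctx d → ℝ) (γ : Env d) (T : ℕ)
    (X : ℕ → Ω → Ctx d) (ε δ : ℕ → Ω → ℝ) : ℝ :=
  ∫ ω, realizedRegret lo hi alg γ T (fun n => X n ω) (fun n => ε n ω) (fun n => δ n ω) ∂μ

/-- The feature vector `Z = (x, a x)`. -/
def feature (x : Ctx d) (a : ℝ) : Fin d ⊕ Fin d → ℝ :=
  Sum.elim (fun i => x i) (fun i => a * x i)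

/-- The matrix `½ Z Zᵀ`. -/
def infoMatrix (x : Ctx d) (a : ℝ) : Matrix (Fin d ⊕ Fin d) (Fin d ⊕ Fin d) ℝ :=
  (1 / 2 : ℝ) • Matrix.vecMulVec (feature x a) (feature x a)

/-- The seminorm `‖z‖_M = √(zᵀ M z)`. -/
def matrixSeminorm (M : Matrix (Fin d ⊕ Fin d) (Fin d ⊕ Fin d) ℝ) (z : Env d) : ℝ :=
  √((fun i => z i) ⬝ᵥ (M *ᵥ fun i => z i))

/-- The log-likelihood ratio between `γ` and `γ'`. -/
def logRatio (γ γ' : Env d) (x : Ctx d) (a D : ℝ) : ℝ :=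
  Real.log (demandDensity γ x a D / demandDensity γ' x a D)

/-- Assumption on the environment space: bounded parameters, bounded expected reward, and a uniform
prior. -/
structure EnvironmentAssumption (Γ : Set (Env d)) (π : Measure (Env d)) (𝒳 : Set (Ctx d))
    (A : Set ℝ) (γbar rbar : ℝ) : Prop where
  norm_le : ∀ γ ∈ Γ, ‖γ‖ ≤ γbar
  reward_le : ∀ x ∈ 𝒳, ∀ a ∈ A, ∀ γ ∈ Γ, expectedRevenue γ x a ≤ rbar
  uniform : IsProbabilityMeasure π ∧ π = ProbabilityTheory.cond volume Γ

/-- Assumption on the observation distribution: a lower bound for the Kullback-Leibler divergence,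
sub-Gaussianity of the (centred) log-likelihood ratio, and concavity and smoothness of the
log-likelihood in the environment. -/
structure ObservationAssumption (Γ : Set (Env d)) (𝒳 : Set (Ctx d)) (A : Set ℝ)
    (Δ : Ctx d → ℝ → Matrix (Fin d ⊕ Fin d) (Fin d ⊕ Fin d) ℝ) (Cσ CΓ : ℝ) : Prop where
  posSemidef : ∀ x ∈ 𝒳, ∀ a ∈ A, (Δ x a).PosSemidef
  le_klDiv : ∀ x ∈ 𝒳, ∀ a ∈ A, ∀ γ ∈ Γ, ∀ γ' ∈ Γ,
    ENNReal.ofReal (matrixSeminorm (Δ x a) (γ - γ') ^ 2) ≤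
      InformationTheory.klDiv (demandLaw γ x a) (demandLaw γ' x a)
  subGaussian : ∀ x ∈ 𝒳, ∀ a ∈ A, ∀ γ ∈ Γ, ∀ γ' ∈ Γ,
    HasSubgaussianMGF
      (fun D => logRatio γ γ' x a D - ∫ D', logRatio γ γ' x a D' ∂(demandLaw γ x a))
      (Real.toNNReal ((Cσ * matrixSeminorm (Δ x a) (γ - γ')) ^ 2)) (demandLaw γ x a)
  concave : ∀ x ∈ 𝒳, ∀ a ∈ A, ∀ D : ℝ,
    ConcaveOn ℝ Γ fun γ' => Real.log (demandDensity γ' x a D)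
  smooth : ∀ x ∈ 𝒳, ∀ a ∈ A, ∀ D : ℝ,
    ContDiff ℝ 2 (fun γ' : Env d => Real.log (demandDensity γ' x a D)) ∧
      ∀ γ' ∈ Γ,
        ‖fderiv ℝ (fderiv ℝ fun γ'' : Env d => Real.log (demandDensity γ'' x a D)) γ'‖ ^ 2 ≤ CΓ

/-- Assumption on the reward gaps, for every environment in `Γ` and every history, made of completed
periods `h` and the current context `x`: the expected revenue lost by the perturbation is at most
`Δexploit`, and that of posterior averaging is at most `Cr` times the posterior mean of the squared
distance to the true environment. -/
structure RewardGapAssumption (Γ : Set (Env d)) (π : Measure (Env d)) (𝒳 : Set (Ctx d))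
    (lo hi C : ℝ) (T : ℕ) (Δexploit Cr : ℝ) : Prop where
  exploit : ∀ γ ∈ Γ, ∀ h : List (Record d), ∀ x ∈ 𝒳,
    ∫ a, (expectedRevenue γ x (algStar lo hi π h x) - expectedRevenue γ x a)
      ∂(tfLaw lo hi π C T h x) ≤ Δexploit
  posteriorGap : ∀ γ ∈ Γ, ∀ h : List (Record d), ∀ x ∈ 𝒳,
    expectedRevenue γ x (optPrice lo hi γ x) - expectedRevenue γ x (algStar lo hi π h x) ≤
      Cr * ∫ γ', ‖γ - γ'‖ ^ 2 ∂(posterior π h)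

end ContextualPricing

end

open ContextualPricing

open ContextualPricing

namespace ContextualPricing

variable {d : ℕ}

/-! ### The mean demand as a linear function of the environment -/

/-! The regret of a period splits at the unperturbed price `algStar`. Moving from it to the posted
price costs little: the revenue is quadratic in the price and the perturbation is centred, so only
curvature times variance survives, of order `C ^ 2 / √T` (`integral_perturbation_loss_le`). Moving
from the optimal price to `algStar` costs at most a constant times the posterior mean of `‖θ - γ‖ ^
2`, where `θ` is the true environment: a slope bounded away from zero makes the revenue strongly
concave, so another environment's optimal price loses only a quadratic amount (`revenue_gap_le`),
and concavity in the price carries this over to the posterior mean (`posterior_gap_le`).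

It remains to bound the expected posterior squared distance after `n` periods by a constant times
`√T (d log n + 1) / n`; summing over `n` is then a harmonic sum. For a fixed `γ`, the conditional
mean over the demand noise of the square root of the one-period likelihood ratio is `exp (-u ^ 2 /
8)`, with `u` the difference of mean demands (a Hellinger affinity). Whatever the price rule, the
perturbation forces the mean of `u ^ 2` to be at least of order `T ^ (-1/2) ‖γ - θ‖ ^ 2`: two
distinct prices separate intercept from slope, and the second-moment matrix of the contexts covers
all directions. Hence, with `c` of order `T ^ (-1/2)`, the variable `exp (½ log (L γ / L θ) + n c ‖θ
- γ‖ ^ 2)` has mean at most 1 (`IsDrivingNoise.lintegral_sqrt_likelihood_ratio_le`).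

This bound is averaged over the prior and moved to the posterior by `1 + x ≤ exp x`
(`mul_integral_posterior_sq_dist_le`). The price is the log-density `log L - log Z` of the posterior
with respect to the prior. To bound it, shrink `Γ` by the factor `1 / n` towards a point: the image
has prior mass `n ^ (-2 d)`, and by concavity the log-likelihood drops there by at most the fraction
`1 / n` of its variation over `Γ`, which is `O(n)` in mean (`pow_mul_exp_le_integral_likelihood`).
Only convexity of `Γ` enters this volume argument, so the constants do not see its shape.

The claims on the observation distribution are Gaussian computations: the log-likelihood is a
concave quadratic in a linear functional of the environment. -/

/-- The feature vector `(x, a x)` as an element of the space of environments. -/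
noncomputable def featureVec (x : Ctx d) (a : ℝ) : Env d := WithLp.toLp 2 (feature x a)

theorem meanDemand_eq_inner (γ : Env d) (x : Ctx d) (a : ℝ) :
    meanDemand γ x a = inner ℝ (featureVec x a) γ := by
  simp only [meanDemand, featureVec, interceptPart, slopePart, feature, PiLp.inner_apply,
    Fintype.sum_sum_type, Sum.elim_inl, Sum.elim_inr, RCLike.inner_apply, conj_trivial,
    Finset.sum_mul]
  congr 1
  · exact Finset.sum_congr rfl fun i _ => mul_comm _ _
  · exact Finset.sum_congr rfl fun i _ => by ring

theorem norm_sq_featureVec (x : Ctx d) (a : ℝ) :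
    ‖featureVec x a‖ ^ 2 = ‖x‖ ^ 2 * (1 + a ^ 2) := by
  simp only [featureVec, feature, EuclideanSpace.norm_sq_eq, Fintype.sum_sum_type, Sum.elim_inl,
    Sum.elim_inr, mul_pow, Real.norm_eq_abs, sq_abs, ← Finset.mul_sum]
  ring

theorem norm_featureVec_le (x : Ctx d) (a : ℝ) : ‖featureVec x a‖ ≤ ‖x‖ * (1 + |a|) := by
  refine le_of_sq_le_sq ?_ (by positivity)
  rw [norm_sq_featureVec, mul_pow]
  have h1 := sq_abs a
  have h2 := abs_nonneg a
  gcongr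
  nlinarith

theorem meanDemand_sub (γ γ' : Env d) (x : Ctx d) (a : ℝ) :
    meanDemand (γ - γ') x a = meanDemand γ x a - meanDemand γ' x a := by
  simp only [meanDemand_eq_inner, inner_sub_right]

theorem abs_meanDemand_le (γ : Env d) (x : Ctx d) (a : ℝ) :
    |meanDemand γ x a| ≤ ‖x‖ * (1 + |a|) * ‖γ‖ := by
  rw [meanDemand_eq_inner]
  exact (abs_real_inner_le_norm _ _).trans
    (mul_le_mul_of_nonneg_right (norm_featureVec_le x a) (norm_nonneg γ))

theorem norm_sq_eq_parts (γ : Env d) :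
    ‖γ‖ ^ 2 = ‖interceptPart γ‖ ^ 2 + ‖slopePart γ‖ ^ 2 := by
  simp [interceptPart, slopePart, EuclideanSpace.norm_sq_eq, Fintype.sum_sum_type]

theorem norm_slopePart_le (γ : Env d) : ‖slopePart γ‖ ≤ ‖γ‖ := by
  refine le_of_sq_le_sq ?_ (norm_nonneg γ)
  rw [norm_sq_eq_parts]
  nlinarith [sq_nonneg ‖interceptPart γ‖]

theorem norm_interceptPart_le (γ : Env d) : ‖interceptPart γ‖ ≤ ‖γ‖ := by
  refine le_of_sq_le_sq ?_ (norm_nonneg γ)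
  rw [norm_sq_eq_parts]
  nlinarith [sq_nonneg ‖slopePart γ‖]

theorem abs_inner_slopePart_le (γ : Env d) (x : Ctx d) :
    |inner ℝ (slopePart γ) x| ≤ ‖γ‖ * ‖x‖ :=
  (abs_real_inner_le_norm _ _).trans
    (mul_le_mul_of_nonneg_right (norm_slopePart_le γ) (norm_nonneg x))

theorem interceptPart_sub (γ γ' : Env d) :
    interceptPart (γ - γ') = interceptPart γ - interceptPart γ' := rfl

theorem slopePart_sub (γ γ' : Env d) : slopePart (γ - γ') = slopePart γ - slopePart γ' := rfl

theorem continuous_interceptPart : Continuous (interceptPart : Env d → Ctx d) := by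
  unfold interceptPart; fun_prop

theorem continuous_slopePart : Continuous (slopePart : Env d → Ctx d) := by
  unfold slopePart; fun_prop

theorem measurable_meanDemand :
    Measurable fun p : Env d × Ctx d × ℝ => meanDemand p.1 p.2.1 p.2.2 := by
  have h1 := (continuous_interceptPart (d := d)).measurable
  have h2 := (continuous_slopePart (d := d)).measurable
  unfold meanDemand
  fun_prop

theorem measurable_expectedRevenue :
    Measurable fun p : Env d × Ctx d × ℝ => expectedRevenue p.1 p.2.1 p.2.2 :=
  measurable_meanDemand.mul measurable_snd.snd

/-! ### The demand density -/

theorem demandDensity_pos (γ : Env d) (x : Ctx d) (a D : ℝ) : 0 < demandDensity γ x a D :=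
  gaussianPDFReal_pos _ _ _ one_ne_zero

theorem log_demandDensity (γ : Env d) (x : Ctx d) (a D : ℝ) :
    Real.log (demandDensity γ x a D) =
      Real.log (√(2 * Real.pi))⁻¹ - (D - meanDemand γ x a) ^ 2 / 2 := by
  have h : (√(2 * Real.pi))⁻¹ ≠ 0 := by positivity
  rw [demandDensity, gaussianPDFReal, NNReal.coe_one, mul_one, mul_one,
    Real.log_mul h (Real.exp_ne_zero _), Real.log_exp]
  ring

theorem measurable_demandDensity :
    Measurable fun p : Env d × Record d => demandDensity p.1 p.2.1 p.2.2.1 p.2.2.2 := by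
  have h : Measurable fun p : Env d × Record d => meanDemand p.1 p.2.1 p.2.2.1 :=
    measurable_meanDemand.comp
      (measurable_fst.prodMk (measurable_snd.fst.prodMk measurable_snd.snd.fst))
  exact measurable_uncurry_gaussianPDFReal.comp
    (h.prodMk (measurable_const.prodMk measurable_snd.snd.snd))

/-- The two Gaussians have equal variance, so the squares of `D` cancel and the ratio is affine in
`D`. Both the divergence and the sub-Gaussian bound are read off this form. -/
theorem logRatio_eq (γ γ' : Env d) (x : Ctx d) (a D : ℝ) :
    logRatio γ γ' x a D =
      meanDemand (γ - γ') x a * (D - meanDemand γ x a) + meanDemand (γ - γ') x a ^ 2 / 2 := by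
  rw [logRatio, Real.log_div (demandDensity_pos _ _ _ _).ne' (demandDensity_pos _ _ _ _).ne',
    log_demandDensity, log_demandDensity, meanDemand_sub]
  ring

theorem integrable_id_demandLaw (γ : Env d) (x : Ctx d) (a : ℝ) :
    Integrable (fun D => D) (demandLaw γ x a) :=
  (memLp_id_gaussianReal (μ := meanDemand γ x a) (v := 1) 1).integrable le_rfl

instance (γ : Env d) (x : Ctx d) (a : ℝ) : IsProbabilityMeasure (demandLaw γ x a) := by
  unfold demandLaw; infer_instance

theorem integral_logRatio (γ γ' : Env d) (x : Ctx d) (a : ℝ) :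
    ∫ D, logRatio γ γ' x a D ∂(demandLaw γ x a) = meanDemand (γ - γ') x a ^ 2 / 2 := by
  have hi := integrable_id_demandLaw γ x a
  simp only [logRatio_eq]
  have hi' : Integrable (fun D => D - meanDemand γ x a) (demandLaw γ x a) :=
    hi.sub (integrable_const _)
  rw [integral_add (hi'.const_mul _) (integrable_const _), integral_const_mul,
    integral_sub hi (integrable_const _)]
  simp [demandLaw, integral_id_gaussianReal]

theorem matrixSeminorm_infoMatrix_sq (x : Ctx d) (a : ℝ) (z : Env d) :
    matrixSeminorm (infoMatrix x a) z ^ 2 = meanDemand z x a ^ 2 / 2 := by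
  have hZ : feature x a ⬝ᵥ (fun i => z i) = meanDemand z x a := by
    rw [meanDemand_eq_inner, PiLp.inner_apply, dotProduct]
    refine Finset.sum_congr rfl fun i _ => ?_
    simp [featureVec, mul_comm]
  have h : (fun i => z i) ⬝ᵥ (infoMatrix x a *ᵥ fun i => z i) = meanDemand z x a ^ 2 / 2 := by
    rw [infoMatrix, Matrix.smul_mulVec, Matrix.vecMulVec_mulVec, hZ, dotProduct_smul,
      dotProduct_smul, dotProduct_comm, hZ]
    simp only [smul_eq_mul, MulOpposite.smul_eq_mul_unop, MulOpposite.unop_op]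
    ring
  rw [matrixSeminorm, h, Real.sq_sqrt (by positivity)]

theorem posSemidef_infoMatrix (x : Ctx d) (a : ℝ) : (infoMatrix x a).PosSemidef := by
  have h := Matrix.posSemidef_vecMulVec_self_star (feature x a)
  rw [star_trivial] at h
  exact h.smul (by norm_num)

theorem le_klDiv_demandLaw (γ γ' : Env d) (x : Ctx d) (a : ℝ) :
    ENNReal.ofReal (meanDemand (γ - γ') x a ^ 2 / 2) ≤
      InformationTheory.klDiv (demandLaw γ x a) (demandLaw γ' x a) := by
  -- If absolute continuity or integrability failed, the divergence would be infinite and the bound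
  -- trivial; so neither has to be proved.
  by_cases h : demandLaw γ x a ≪ demandLaw γ' x a ∧
      Integrable (llr (demandLaw γ x a) (demandLaw γ' x a)) (demandLaw γ x a)
  swap
  · rw [not_imp_comm.1 InformationTheory.klDiv_ne_top_iff.1 h]
    exact le_top
  rw [InformationTheory.klDiv_of_ac_of_integrable h.1 h.2]
  refine ENNReal.ofReal_le_ofReal (le_of_eq ?_)
  have hv : demandLaw γ x a ≪ volume := gaussianReal_absolutelyContinuous _ one_ne_zero
  have hv' : volume ≪ demandLaw γ' x a := gaussianReal_absolutelyContinuous' _ one_ne_zero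
  have hchain := Measure.rnDeriv_mul_rnDeriv (κ := demandLaw γ' x a) hv
  have hinv := Measure.inv_rnDeriv (μ := demandLaw γ' x a) (ν := volume)
    (gaussianReal_absolutelyContinuous _ one_ne_zero)
  have h1 : (demandLaw γ x a).rnDeriv volume =ᵐ[volume]
      gaussianPDF (meanDemand γ x a) 1 := rnDeriv_gaussianReal _ _
  have h2 : (demandLaw γ' x a).rnDeriv volume =ᵐ[volume]
      gaussianPDF (meanDemand γ' x a) 1 := rnDeriv_gaussianReal _ _
  -- Chain rule through Lebesgue measure: the abstract derivative is the quotient of the two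
  -- Gaussian densities.
  have key : llr (demandLaw γ x a) (demandLaw γ' x a) =ᵐ[demandLaw γ x a]
      logRatio γ γ' x a := by
    filter_upwards [h.1 hchain, h.1 hinv, hv h1, hv h2] with D e1 e2 e3 e4
    rw [llr_def]
    simp only [logRatio]
    rw [← e1, Pi.mul_apply, ← e2, Pi.inv_apply, e3, e4, ENNReal.toReal_mul, ENNReal.toReal_inv,
      toReal_gaussianPDF, toReal_gaussianPDF, div_eq_mul_inv]
    rfl
  rw [integral_congr_ae key, integral_logRatio]
  simp

/-- After centring, what remains is `u` times a standard Gaussian, whose moment generating function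
is exactly that of variance `u ^ 2`. -/
theorem hasSubgaussianMGF_logRatio (γ γ' : Env d) (x : Ctx d) (a : ℝ) {c : ℝ≥0}
    (hc : (c : ℝ) = meanDemand (γ - γ') x a ^ 2) :
    HasSubgaussianMGF
      (fun D => logRatio γ γ' x a D - ∫ D', logRatio γ γ' x a D' ∂(demandLaw γ x a))
      c (demandLaw γ x a) := by
  set u := meanDemand (γ - γ') x a with hu
  set m := meanDemand γ x a with hm
  have hf : (fun D => logRatio γ γ' x a D - ∫ D', logRatio γ γ' x a D' ∂(demandLaw γ x a)) =
      fun D => u * (D - m) := by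
    funext D
    rw [integral_logRatio, logRatio_eq]
    ring
  have hexp : ∀ t D : ℝ, Real.exp (t * (u * (D - m))) =
      Real.exp (-(t * u * m)) * Real.exp (t * u * D) := by
    intro t D
    rw [← Real.exp_add]
    congr 1
    ring
  rw [hf]
  refine ⟨fun t => ?_, fun t => le_of_eq ?_⟩
  · simp only [hexp]
    exact (integrable_exp_mul_gaussianReal (t * u)).const_mul _
  · simp only [mgf, hexp]
    rw [integral_const_mul]
    have h := congrFun (mgf_id_gaussianReal (μ := m) (v := 1)) (t * u)
    simp only [mgf, id_eq] at h
    rw [demandLaw, ← hm, h, ← Real.exp_add, hc, NNReal.coe_one]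
    congr 1
    ring

theorem concaveOn_log_demandDensity {Γ : Set (Env d)} (hΓ : Convex ℝ Γ) (x : Ctx d) (a D : ℝ) :
    ConcaveOn ℝ Γ fun γ => Real.log (demandDensity γ x a D) := by
  refine ⟨hΓ, fun γ₁ _ γ₂ _ s t hs ht hst => ?_⟩
  simp only [log_demandDensity, meanDemand_eq_inner, inner_add_right, inner_smul_right, smul_eq_mul]
  obtain rfl : s = 1 - t := by linarith
  nlinarith [mul_nonneg (mul_nonneg hs ht)
    (sq_nonneg (inner ℝ (featureVec x a) γ₁ - inner ℝ (featureVec x a) γ₂))]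

theorem contDiff_log_demandDensity (x : Ctx d) (a D : ℝ) :
    ContDiff ℝ 2 fun γ : Env d => Real.log (demandDensity γ x a D) := by
  simp only [log_demandDensity, meanDemand_eq_inner]
  have h : ContDiff ℝ 2 fun γ : Env d => (inner ℝ (featureVec x a) γ : ℝ) :=
    contDiff_const.inner ℝ contDiff_id
  fun_prop

/-- The second derivative is the constant rank-one form `-z ⊗ z`, with `z` the functional of the
feature vector; it does not depend on `D` or `γ`. -/
theorem norm_fderiv_fderiv_log_demandDensity_le (x : Ctx d) (a D : ℝ) (γ : Env d) :
    ‖fderiv ℝ (fderiv ℝ fun γ' : Env d => Real.log (demandDensity γ' x a D)) γ‖ ≤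
      ‖featureVec x a‖ ^ 2 := by
  set z : Env d →L[ℝ] ℝ := innerSL ℝ (featureVec x a) with hz
  have hz' : ‖z‖ = ‖featureVec x a‖ := innerSL_apply_norm ..
  have hf : (fun γ' : Env d => Real.log (demandDensity γ' x a D)) =
      fun γ' => Real.log (√(2 * Real.pi))⁻¹ - (D - z γ') ^ 2 / 2 := by
    funext γ'
    rw [log_demandDensity, meanDemand_eq_inner, hz, innerSL_apply_apply]
  have h1 : fderiv ℝ (fun γ' : Env d => Real.log (demandDensity γ' x a D)) =
      fun γ' => (D - z γ') • z := by
    funext γ'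
    rw [hf]
    have h := ((z.hasFDerivAt (x := γ')).const_sub D).pow 2
    have h' := (h.mul_const (2⁻¹ : ℝ)).const_sub (Real.log (√(2 * Real.pi))⁻¹)
    simp only [← div_eq_mul_inv] at h'
    rw [h'.fderiv]
    ext v
    simp
    ring
  have h2 : HasFDerivAt (fun γ' : Env d => (D - z γ') • z)
      ((-z).smulRight z) γ :=
    ((z.hasFDerivAt (x := γ)).const_sub D).smul_const z
  rw [h1, h2.fderiv, ContinuousLinearMap.norm_smulRight_apply, norm_neg, hz', sq]

end ContextualPricing

namespace ContextualPricing

variable {d : ℕ} {lo hi : ℝ}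

/-! ### The optimal price -/

theorem expectedRevenue_eq (γ : Env d) (x : Ctx d) (a : ℝ) :
    expectedRevenue γ x a =
      inner ℝ (interceptPart γ) x * a + inner ℝ (slopePart γ) x * a ^ 2 := by
  rw [expectedRevenue, meanDemand]; ring

theorem optPrice_eq_of_forall {γ : Env d} {x : Ctx d} {a : ℝ} (ha : a ∈ Icc lo hi)
    (hmax : ∀ c ∈ Icc lo hi, expectedRevenue γ x c ≤ expectedRevenue γ x a)
    (huniq : ∀ c ∈ Icc lo hi, expectedRevenue γ x a ≤ expectedRevenue γ x c → c ≤ a) :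
    optPrice lo hi γ x = a :=
  IsGreatest.csSup_eq ⟨⟨ha, hmax⟩, fun c hc => huniq c hc.1 (hc.2 ha)⟩

/-- The maximiser `m` of a concave parabola on an interval is the projection of its vertex `u`. With
`p = -2 q u`, the gap equals `-q ((c - m) ^ 2 + 2 (c - m) (m - u))`, and the projection inequality
makes the cross term nonnegative. -/
theorem clamp_spec (h : lo ≤ hi) {p q : ℝ} (hq : q < 0) {c : ℝ}
    (hc : c ∈ Icc lo hi) :
    -q * (max lo (min hi (-p / (2 * q))) - c) ^ 2 ≤
      (p * max lo (min hi (-p / (2 * q))) + q * max lo (min hi (-p / (2 * q))) ^ 2) -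
        (p * c + q * c ^ 2) := by
  set u := -p / (2 * q) with hu
  have hp : p = -2 * q * u := by
    rw [hu]; field_simp [hq.ne]
  set m := max lo (min hi u) with hm
  have hkey : 0 ≤ (c - m) * (m - u) := by
    rcases le_total u lo with h1 | h1
    · have : m = lo := by rw [hm, max_eq_left ((min_le_right _ _).trans h1)]
      rw [this]
      exact mul_nonneg (by linarith [hc.1]) (by linarith)
    · rcases le_total u hi with h2 | h2
      · have : m = u := by rw [hm, min_eq_right h2, max_eq_right h1]
        rw [this]; simp
      · have : m = hi := by rw [hm, min_eq_left h2, max_eq_right h]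
        rw [this]
        exact mul_nonneg_of_nonpos_of_nonpos (by linarith [hc.2]) (by linarith)
  rw [hp]
  nlinarith [mul_nonneg (neg_pos.2 hq).le hkey]

open Classical in
-- A closed form, from which joint measurability follows. It must hold for all environments, also
-- those with nonnegative slope: there the revenue is convex and an endpoint wins, ties going to
-- `hi` as the definition takes the largest maximiser.
theorem optPrice_eq (h : lo ≤ hi) (γ : Env d) (x : Ctx d) :
    optPrice lo hi γ x =
      if inner ℝ (slopePart γ) x < 0 then
        max lo (min hi (-inner ℝ (interceptPart γ) x / (2 * inner ℝ (slopePart γ) x)))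
      else if expectedRevenue γ x lo ≤ expectedRevenue γ x hi then hi else lo := by
  set p : ℝ := inner ℝ (interceptPart γ) x with hp
  set q : ℝ := inner ℝ (slopePart γ) x with hq
  have hr : ∀ a, expectedRevenue γ x a = p * a + q * a ^ 2 := expectedRevenue_eq γ x
  simp only [hr]
  split_ifs with h1 h2
  · refine optPrice_eq_of_forall ⟨le_max_left _ _, max_le h (min_le_left _ _)⟩
      (fun c hc => ?_) (fun c hc hle => ?_)
    · have h3 := clamp_spec h (p := p) h1 hc
      rw [hr, hr]
      nlinarith [mul_nonneg (neg_pos.2 h1).le (sq_nonneg (max lo (min hi (-p / (2 * q))) - c))]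
    · have h3 := clamp_spec h (p := p) h1 hc
      rw [hr, hr] at hle
      have h4 : -q * (max lo (min hi (-p / (2 * q))) - c) ^ 2 ≤ 0 := by linarith
      have h5 : (max lo (min hi (-p / (2 * q))) - c) ^ 2 ≤ 0 := by
        by_contra hcon
        push Not at hcon
        nlinarith [mul_pos (neg_pos.2 h1) hcon]
      have h6 := pow_eq_zero_iff two_ne_zero |>.1 (le_antisymm h5 (sq_nonneg _))
      linarith
  · rw [not_lt] at h1
    refine optPrice_eq_of_forall ⟨h, le_rfl⟩ (fun c hc => ?_) (fun c hc _ => hc.2)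
    rw [hr, hr]
    -- `p + q * (hi + c)` is the slope of the chord from `c` to `hi`. If it is negative, convexity
    -- makes the chord from `lo` to `c` slope down too, so `lo` beats `c`, and `hi` beats `lo`.
    rcases le_or_gt 0 (p + q * (hi + c)) with h3 | h3
    · nlinarith [mul_nonneg (sub_nonneg.2 hc.2) h3]
    · have h4 : p + q * (lo + c) ≤ 0 := by nlinarith [mul_nonneg h1 (sub_nonneg.2 h)]
      nlinarith [mul_nonneg (sub_nonneg.2 hc.1) (neg_nonneg.2 h4)]
  · rw [not_lt] at h1
    rw [not_le] at h2
    have h3 : p + q * (hi + lo) < 0 := by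
      by_contra hcon
      push Not at hcon
      nlinarith [mul_nonneg (sub_nonneg.2 h) hcon]
    have h4 : ∀ c ∈ Icc lo hi, p + q * (c + lo) < 0 := fun c hc => by
      nlinarith [mul_nonneg h1 (sub_nonneg.2 hc.2)]
    refine optPrice_eq_of_forall ⟨le_rfl, h⟩ (fun c hc => ?_) (fun c hc hle => ?_)
    · rw [hr, hr]
      nlinarith [mul_nonneg (sub_nonneg.2 hc.1) (neg_pos.2 (h4 c hc)).le]
    · rw [hr, hr] at hle
      by_contra hcon
      push Not at hcon
      nlinarith [mul_pos (sub_pos.2 hcon) (neg_pos.2 (h4 c hc))]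

theorem measurable_optPrice (h : lo ≤ hi) :
    Measurable fun p : Env d × Ctx d => optPrice lo hi p.1 p.2 := by
  classical
  simp only [optPrice_eq h]
  have h1 := (continuous_interceptPart (d := d)).measurable
  have h2 := (continuous_slopePart (d := d)).measurable
  have hr : ∀ a, Measurable fun p : Env d × Ctx d => expectedRevenue p.1 p.2 a := fun a => by
    have hg : Measurable fun p : Env d × Ctx d => (p.1, p.2, a) := by fun_prop
    exact (measurable_expectedRevenue.comp hg :)
  have hp : Measurable fun p : Env d × Ctx d => (inner ℝ (interceptPart p.1) p.2 : ℝ) :=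
    (h1.comp measurable_fst).inner measurable_snd
  have hq : Measurable fun p : Env d × Ctx d => (inner ℝ (slopePart p.1) p.2 : ℝ) :=
    (h2.comp measurable_fst).inner measurable_snd
  refine Measurable.ite (measurableSet_lt hq measurable_const) (by fun_prop) ?_
  exact Measurable.ite (measurableSet_le (hr lo) (hr hi)) measurable_const measurable_const

theorem slope_mul_sq_le_revenue_gap (h : lo ≤ hi) {γ : Env d} {x : Ctx d} {b : ℝ} (hb : 0 < b)
    (hslope : inner ℝ (slopePart γ) x ≤ -b) {a : ℝ} (ha : a ∈ Icc lo hi) :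
    b * (optPrice lo hi γ x - a) ^ 2 ≤
      expectedRevenue γ x (optPrice lo hi γ x) - expectedRevenue γ x a := by
  have hq : (inner ℝ (slopePart γ) x : ℝ) < 0 := by linarith
  have h1 := clamp_spec h (p := inner ℝ (interceptPart γ) x) hq ha
  classical
  rw [← if_pos (c := (inner ℝ (slopePart γ) x : ℝ) < 0)
    (t := max lo (min hi (-inner ℝ (interceptPart γ) x / (2 * inner ℝ (slopePart γ) x))))
    (e := if expectedRevenue γ x lo ≤ expectedRevenue γ x hi then hi else lo) hq,
    ← optPrice_eq h, ← expectedRevenue_eq, ← expectedRevenue_eq] at h1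
  refine le_trans ?_ h1
  exact mul_le_mul_of_nonneg_right (by linarith) (sq_nonneg _)

/-- The revenue lost by posting the optimal price of another environment is quadratic in the
distance of the environments. -/
theorem revenue_gap_le (hlo : 0 < lo) (h : lo ≤ hi) {γ γ' : Env d} {x : Ctx d} {b Xbar : ℝ}
    (hb : 0 < b) (hx : ‖x‖ ≤ Xbar) (hγ' : inner ℝ (slopePart γ') x ≤ -b) :
    expectedRevenue γ x (optPrice lo hi γ x) - expectedRevenue γ x (optPrice lo hi γ' x) ≤
      (Xbar * (1 + 2 * hi)) ^ 2 / (4 * b) * ‖γ - γ'‖ ^ 2 := by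
  have ha := (optPrice_spec h γ x).1
  have ha' := (optPrice_spec h γ' x).1
  have hgap := slope_mul_sq_le_revenue_gap h hb hγ' ha
  set a := optPrice lo hi γ x
  set a' := optPrice lo hi γ' x
  have hX : 0 ≤ Xbar := (norm_nonneg x).trans hx
  -- The difference of revenues under `γ` is that under `γ - γ'`, linear in both `γ - γ'` and `a -
  -- a'`, minus the gap under `γ'`, which is at least `b (a - a') ^ 2`.
  have e : expectedRevenue γ x a - expectedRevenue γ x a' =
      (inner ℝ (interceptPart (γ - γ')) x + inner ℝ (slopePart (γ - γ')) x * (a + a')) * (a - a')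
        - (expectedRevenue γ' x a' - expectedRevenue γ' x a) := by
    simp only [expectedRevenue_eq, interceptPart_sub, slopePart_sub, inner_sub_left]
    ring
  have hD : |inner ℝ (interceptPart (γ - γ')) x + inner ℝ (slopePart (γ - γ')) x * (a + a')| ≤
      Xbar * (1 + 2 * hi) * ‖γ - γ'‖ := by
    have h1 : |inner ℝ (interceptPart (γ - γ')) x| ≤ ‖γ - γ'‖ * Xbar :=
      (abs_real_inner_le_norm _ _).trans (by gcongr; exact norm_interceptPart_le _)
    have h2 : |inner ℝ (slopePart (γ - γ')) x| ≤ ‖γ - γ'‖ * Xbar :=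
      (abs_inner_slopePart_le _ _).trans (by gcongr)
    have h3 : |a + a'| ≤ 2 * hi := by
      rw [abs_of_nonneg (by linarith [ha.1, ha'.1])]
      linarith [ha.2, ha'.2]
    calc _ ≤ ‖γ - γ'‖ * Xbar + ‖γ - γ'‖ * Xbar * (2 * hi) := by
          refine (abs_add_le _ _).trans (add_le_add h1 ?_)
          rw [abs_mul]
          gcongr
      _ = _ := by ring
  set M := Xbar * (1 + 2 * hi) * ‖γ - γ'‖ with hM
  have h4 : (inner ℝ (interceptPart (γ - γ')) x + inner ℝ (slopePart (γ - γ')) x * (a + a')) *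
      (a - a') ≤ M * |a - a'| :=
    (le_abs_self _).trans (by rw [abs_mul]; gcongr)
  -- Maximum over `t` of `M t - b t ^ 2`: the unknown price difference disappears.
  have h5 : M * |a - a'| - b * (a - a') ^ 2 ≤ M ^ 2 / (4 * b) := by
    rw [le_div_iff₀ (by positivity), ← sq_abs (a - a')]
    nlinarith [sq_nonneg (M - 2 * b * |a - a'|)]
  have h6 : (Xbar * (1 + 2 * hi)) ^ 2 / (4 * b) * ‖γ - γ'‖ ^ 2 = M ^ 2 / (4 * b) := by
    rw [hM]; ring
  rw [h6, e]
  nlinarith [sq_nonneg (a - a')]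

/-! ### The posterior -/

theorem demandDensity_le_one (γ : Env d) (x : Ctx d) (a D : ℝ) : demandDensity γ x a D ≤ 1 := by
  rw [demandDensity, gaussianPDFReal]
  refine mul_le_one₀ ?_ (Real.exp_nonneg _) ?_
  · refine inv_le_one_of_one_le₀ ?_
    rw [NNReal.coe_one, mul_one, Real.one_le_sqrt]
    linarith [Real.pi_gt_three]
  · rw [Real.exp_le_one_iff]
    have := sq_nonneg (D - meanDemand γ x a)
    rw [neg_div, neg_nonpos]
    positivity

theorem likelihood_cons (z : Record d) (h : List (Record d)) (γ : Env d) :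
    likelihood (z :: h) γ = demandDensity γ z.1 z.2.1 z.2.2 * likelihood h γ := by
  simp [likelihood]

theorem likelihood_pos (h : List (Record d)) (γ : Env d) : 0 < likelihood h γ := by
  induction h with
  | nil => simp [likelihood]
  | cons z h ih => rw [likelihood_cons]; exact mul_pos (demandDensity_pos _ _ _ _) ih

theorem likelihood_le_one (h : List (Record d)) (γ : Env d) : likelihood h γ ≤ 1 := by
  induction h with
  | nil => simp [likelihood]
  | cons z h ih =>
    rw [likelihood_cons]
    exact mul_le_one₀ (demandDensity_le_one _ _ _ _) (likelihood_pos h γ).le ih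

theorem likelihood_ofFn {n : ℕ} (y : Fin n → Record d) (γ : Env d) :
    likelihood (List.ofFn y) γ = ∏ i, demandDensity γ (y i).1 (y i).2.1 (y i).2.2 := by
  rw [likelihood, List.map_ofFn, List.prod_ofFn]
  rfl

theorem measurable_likelihood_ofFn (n : ℕ) :
    Measurable fun p : (Fin n → Record d) × Env d => likelihood (List.ofFn p.1) p.2 := by
  simp only [likelihood_ofFn]
  refine Finset.measurable_prod _ fun i _ => ?_
  have hg : Measurable fun p : (Fin n → Record d) × Env d => (p.2, p.1 i) := by fun_prop
  exact (measurable_demandDensity.comp hg :)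

theorem measurable_likelihood (h : List (Record d)) : Measurable (likelihood h) := by
  have hg : Measurable fun γ : Env d => (h.get, γ) := by fun_prop
  have h1 := (measurable_likelihood_ofFn (d := d) h.length).comp hg
  simpa [Function.comp_def, List.ofFn_get] using h1

theorem posterior_absolutelyContinuous (π : Measure (Env d)) (h : List (Record d)) :
    posterior π h ≪ π :=
  (withDensity_absolutelyContinuous _ _).smul_left _

variable {π : Measure (Env d)} [IsProbabilityMeasure π]

theorem integrable_likelihood (h : List (Record d)) : Integrable (likelihood h) π :=
  Integrable.of_bound (measurable_likelihood h).aestronglyMeasurable 1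
    (Filter.Eventually.of_forall fun γ => by
      rw [Real.norm_eq_abs, abs_of_pos (likelihood_pos h γ)]
      exact likelihood_le_one h γ)

theorem integral_likelihood_pos (h : List (Record d)) : 0 < ∫ γ, likelihood h γ ∂π := by
  rw [integral_pos_iff_support_of_nonneg (fun γ => (likelihood_pos h γ).le)
    (integrable_likelihood h)]
  have : Function.support (likelihood h) = univ := by
    ext γ; simp [(likelihood_pos h γ).ne']
  rw [this]
  simp

theorem lintegral_likelihood (h : List (Record d)) :
    ∫⁻ γ, ENNReal.ofReal (likelihood h γ) ∂π = ENNReal.ofReal (∫ γ, likelihood h γ ∂π) :=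
  (ofReal_integral_eq_lintegral_ofReal (integrable_likelihood h)
    (Filter.Eventually.of_forall fun γ => (likelihood_pos h γ).le)).symm

instance isProbabilityMeasure_posterior (h : List (Record d)) :
    IsProbabilityMeasure (posterior π h) := by
  refine ⟨?_⟩
  rw [posterior, Measure.smul_apply, withDensity_apply _ MeasurableSet.univ,
    Measure.restrict_univ, smul_eq_mul, lintegral_likelihood]
  exact ENNReal.inv_mul_cancel (by simpa using integral_likelihood_pos h) ENNReal.ofReal_ne_top

/-- Turns posterior means into quotients of prior integrals, whose measurability in the history
follows from Fubini. -/
theorem integral_posterior (h : List (Record d)) (f : Env d → ℝ) :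
    ∫ γ, f γ ∂(posterior π h) =
      (∫ γ, likelihood h γ ∂π)⁻¹ * ∫ γ, likelihood h γ * f γ ∂π := by
  rw [posterior, integral_smul_measure, lintegral_likelihood, ENNReal.toReal_inv,
    ENNReal.toReal_ofReal (integral_likelihood_pos h).le,
    integral_withDensity_eq_integral_toReal_smul (measurable_likelihood h).ennreal_ofReal
      (Filter.Eventually.of_forall fun _ => ENNReal.ofReal_lt_top), smul_eq_mul]
  congr 1
  refine integral_congr_ae (Filter.Eventually.of_forall fun γ => ?_)
  simp only [ENNReal.toReal_ofReal (likelihood_pos h γ).le, smul_eq_mul]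

theorem measurable_integral_posterior {α : Type*} [MeasurableSpace α] {n : ℕ}
    {y : α → Fin n → Record d} (hy : Measurable y) {f : α → Env d → ℝ}
    (hf : Measurable fun p : α × Env d => f p.1 p.2) :
    Measurable fun a => ∫ γ, f a γ ∂(posterior π (List.ofFn (y a))) := by
  simp only [integral_posterior]
  have hL : Measurable fun p : α × Env d => likelihood (List.ofFn (y p.1)) p.2 := by
    have hg : Measurable fun p : α × Env d => (y p.1, p.2) := by fun_prop
    exact (measurable_likelihood_ofFn n |>.comp hg :)
  exact (hL.stronglyMeasurable.integral_prod_right.measurable.inv).mul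
    (hL.mul hf).stronglyMeasurable.integral_prod_right.measurable

/-! ### Posterior averaging -/

theorem integrable_optPrice (h : lo ≤ hi) (ν : Measure (Env d)) [IsProbabilityMeasure ν]
    (x : Ctx d) : Integrable (fun γ => optPrice lo hi γ x) ν := by
  have hg : Measurable fun γ : Env d => (γ, x) := by fun_prop
  have hm : Measurable fun γ : Env d => optPrice lo hi γ x := ((measurable_optPrice h).comp hg :)
  exact Integrable.of_mem_Icc lo hi hm.aemeasurable
    (Filter.Eventually.of_forall fun γ => (optPrice_spec h γ x).1)

theorem algStar_mem_Icc (h : lo ≤ hi) (l : List (Record d)) (x : Ctx d) :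
    algStar lo hi π l x ∈ Icc lo hi := by
  have hi' := integrable_optPrice h (posterior π l) x
  constructor
  · have h1 := integral_mono (μ := posterior π l) (integrable_const lo) hi'
      fun γ => (optPrice_spec h γ x).1.1
    simpa [algStar] using h1
  · have h1 := integral_mono (μ := posterior π l) hi' (integrable_const hi)
      fun γ => (optPrice_spec h γ x).1.2
    simpa [algStar] using h1

theorem measurable_algStar_ofFn (h : lo ≤ hi) (n : ℕ) :
    Measurable fun p : (Fin n → Record d) × Ctx d => algStar lo hi π (List.ofFn p.1) p.2 := by
  have hg : Measurable fun p : ((Fin n → Record d) × Ctx d) × Env d => (p.2, p.1.2) := by fun_prop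
  have hm : Measurable fun p : ((Fin n → Record d) × Ctx d) × Env d =>
      optPrice lo hi p.2 p.1.2 := ((measurable_optPrice h).comp hg :)
  unfold algStar
  exact measurable_integral_posterior (f := fun p γ => optPrice lo hi γ p.2) measurable_fst hm

theorem integrable_norm_sub_sq {ν : Measure (Env d)} [IsProbabilityMeasure ν] {Γ : Set (Env d)}
    (hν : ∀ᵐ γ ∂ν, γ ∈ Γ) {γbar : ℝ} (hΓ : ∀ γ ∈ Γ, ‖γ‖ ≤ γbar) (θ : Env d) :
    Integrable (fun γ => ‖θ - γ‖ ^ 2) ν := by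
  refine Integrable.of_bound (by fun_prop) ((‖θ‖ + γbar) ^ 2) ?_
  filter_upwards [hν] with γ hγ
  rw [norm_pow, norm_norm]
  gcongr
  exact (norm_sub_le _ _).trans (by gcongr; exact hΓ γ hγ)

/-- Jensen's inequality in tangent form. The revenue of each candidate price lies below the tangent
at the posterior mean price `m`; the linear term integrates to zero, and what is left is the
posterior mean of the pairwise bound `revenue_gap_le`. -/
theorem posterior_gap_le (hlo : 0 < lo) (h : lo ≤ hi) {Γ : Set (Env d)}
    (hπ : ∀ᵐ γ ∂π, γ ∈ Γ) {γbar : ℝ} (hΓ : ∀ γ ∈ Γ, ‖γ‖ ≤ γbar) {x : Ctx d} {b Xbar : ℝ}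
    (hb : 0 < b) (hx : ‖x‖ ≤ Xbar) (hslope : ∀ γ ∈ Γ, inner ℝ (slopePart γ) x ≤ -b)
    {θ : Env d} (hθ : θ ∈ Γ) (l : List (Record d)) :
    expectedRevenue θ x (optPrice lo hi θ x) - expectedRevenue θ x (algStar lo hi π l x) ≤
      (Xbar * (1 + 2 * hi)) ^ 2 / (4 * b) * ∫ γ, ‖θ - γ‖ ^ 2 ∂(posterior π l) := by
  have hP : ∀ᵐ γ ∂(posterior π l), γ ∈ Γ := posterior_absolutelyContinuous π l hπ
  have hI := integrable_norm_sub_sq hP hΓ θ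
  have hO := integrable_optPrice h (posterior π l) x
  set c := (Xbar * (1 + 2 * hi)) ^ 2 / (4 * b)
  set m := algStar lo hi π l x with hm
  set k : ℝ := inner ℝ (interceptPart θ) x + 2 * inner ℝ (slopePart θ) x * m
  have hO' : Integrable (fun γ => optPrice lo hi γ x - m) (posterior π l) :=
    hO.sub (integrable_const m)
  have key : ∀ᵐ γ ∂(posterior π l),
      expectedRevenue θ x (optPrice lo hi θ x) - expectedRevenue θ x m ≤
        c * ‖θ - γ‖ ^ 2 + k * (optPrice lo hi γ x - m) := by
    filter_upwards [hP] with γ hγ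
    have h1 := revenue_gap_le hlo h (γ := θ) hb hx (hslope γ hγ)
    have h2 : expectedRevenue θ x (optPrice lo hi γ x) ≤
        expectedRevenue θ x m + k * (optPrice lo hi γ x - m) := by
      have h3 := hslope θ hθ
      simp only [expectedRevenue_eq, k]
      nlinarith [mul_nonneg (by linarith : 0 ≤ -(inner ℝ (slopePart θ) x : ℝ))
        (sq_nonneg (optPrice lo hi γ x - m))]
    linarith
  have h1 := integral_mono_ae (integrable_const _) ((hI.const_mul c).add (hO'.const_mul k)) key
  simp only [Pi.add_apply] at h1
  rw [integral_add (hI.const_mul c) (hO'.const_mul k), integral_const_mul, integral_const_mul,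
    integral_sub hO (integrable_const m)] at h1
  have h2 : ∫ γ, optPrice lo hi γ x ∂(posterior π l) = m := rfl
  simpa [h2] using h1

/-! ### The perturbation -/

theorem perturbationSize_pos {C : ℝ} (hC : 0 < C) {T : ℕ} (hT : 1 ≤ T) :
    0 < perturbationSize C T := by
  have : (0 : ℝ) < T := by exact_mod_cast hT
  unfold perturbationSize
  positivity

theorem perturbationSize_le {C : ℝ} (hC : 0 < C) {T : ℕ} (hT : 1 ≤ T) :
    perturbationSize C T ≤ C := by
  have : (1 : ℝ) ≤ T := by exact_mod_cast hT
  exact mul_le_of_le_one_right hC.le (Real.rpow_le_one_of_one_le_of_nonpos this (by norm_num))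

theorem perturbationSize_sq (C : ℝ) (T : ℕ) : perturbationSize C T ^ 2 = C ^ 2 / √(T : ℝ) := by
  have hT : (0 : ℝ) ≤ T := Nat.cast_nonneg T
  rw [perturbationSize, mul_pow, ← Real.rpow_mul_natCast hT, Real.sqrt_eq_rpow,
    div_eq_mul_inv (C ^ 2), ← Real.rpow_neg hT]
  congr 2
  norm_num

instance (C : ℝ) (T : ℕ) : IsProbabilityMeasure (perturbationLaw C T) := by
  refine ⟨?_⟩
  simp [perturbationLaw, ENNReal.inv_two_add_inv_two]

theorem integral_perturbationLaw (C : ℝ) (T : ℕ) (f : ℝ → ℝ) :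
    ∫ δ, f δ ∂(perturbationLaw C T) =
      (f (perturbationSize C T) + f (-perturbationSize C T)) / 2 := by
  have h : ∀ s : ℝ, Integrable f ((2⁻¹ : ℝ≥0∞) • Measure.dirac s) := fun s =>
    (integrable_dirac (by finiteness)).smul_measure (by simp)
  rw [perturbationLaw, integral_add_measure (h _) (h _), integral_smul_measure,
    integral_smul_measure, integral_dirac, integral_dirac]
  simp only [ENNReal.toReal_inv, ENNReal.toReal_ofNat, smul_eq_mul]
  ring

theorem ae_abs_eq_perturbationLaw (C : ℝ) (T : ℕ) :
    ∀ᵐ δ ∂(perturbationLaw C T), |δ| = |perturbationSize C T| := by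
  rw [perturbationLaw, ae_add_measure_iff]
  constructor <;> refine Measure.ae_smul_measure ?_ _ <;> simp [ae_dirac_eq]

/-- The linear parts of the two signs cancel, so the loss does not depend on the price `a`. -/
theorem integral_perturbation_loss (γ : Env d) (x : Ctx d) (a C : ℝ) (T : ℕ) :
    ∫ δ, (expectedRevenue γ x a - expectedRevenue γ x (a + δ)) ∂(perturbationLaw C T) =
      -inner ℝ (slopePart γ) x * (C ^ 2 / √(T : ℝ)) := by
  rw [integral_perturbationLaw, ← perturbationSize_sq]
  simp only [expectedRevenue_eq]
  ring

theorem integral_perturbation_loss_le {γ : Env d} {x : Ctx d} {γbar Xbar : ℝ}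
    (hγ : ‖γ‖ ≤ γbar) (hx : ‖x‖ ≤ Xbar) (a C : ℝ) (T : ℕ) :
    ∫ δ, (expectedRevenue γ x a - expectedRevenue γ x (a + δ)) ∂(perturbationLaw C T) ≤
      Xbar * γbar * C ^ 2 / √(T : ℝ) := by
  rw [integral_perturbation_loss, mul_div_assoc]
  refine mul_le_mul_of_nonneg_right ?_ (by positivity)
  calc -inner ℝ (slopePart γ) x ≤ |inner ℝ (slopePart γ) x| := neg_le_abs _
    _ ≤ ‖γ‖ * ‖x‖ := abs_inner_slopePart_le γ x
    _ ≤ γbar * Xbar := mul_le_mul hγ hx (norm_nonneg _) ((norm_nonneg _).trans hγ)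
    _ = _ := mul_comm _ _

theorem integral_tfLaw (ρ : Measure (Env d)) (l : List (Record d)) (x : Ctx d) (C : ℝ) (T : ℕ) {f : ℝ → ℝ}
    (hf : Measurable f) :
    ∫ a, f a ∂(tfLaw lo hi ρ C T l x) =
      ∫ δ, f (algStar lo hi ρ l x + δ) ∂(perturbationLaw C T) :=
  integral_map (by fun_prop) hf.aestronglyMeasurable

end ContextualPricing

namespace ContextualPricing

variable {d : ℕ}

/-! ### The log-likelihood -/

theorem log_likelihood_cons (z : Record d) (l : List (Record d)) (γ : Env d) :
    Real.log (likelihood (z :: l) γ) =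
      Real.log (demandDensity γ z.1 z.2.1 z.2.2) + Real.log (likelihood l γ) := by
  rw [likelihood_cons, Real.log_mul (demandDensity_pos _ _ _ _).ne' (likelihood_pos _ _).ne']

theorem concaveOn_log_likelihood (l : List (Record d)) :
    ConcaveOn ℝ univ fun γ => Real.log (likelihood l γ) := by
  induction l with
  | nil => simpa [likelihood] using concaveOn_const (0 : ℝ) convex_univ
  | cons z l ih =>
    simp only [log_likelihood_cons]
    exact (concaveOn_log_demandDensity convex_univ _ _ _).add ih

theorem log_demandDensity_sub (γ θ : Env d) (x : Ctx d) (a D : ℝ) :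
    Real.log (demandDensity γ x a D) - Real.log (demandDensity θ x a D) =
      (D - meanDemand θ x a) * meanDemand (γ - θ) x a - meanDemand (γ - θ) x a ^ 2 / 2 := by
  rw [log_demandDensity, log_demandDensity, meanDemand_sub]
  ring

/-- A bound for the variation of the log-likelihood around `θ` over environments whose mean demands
differ from those of `θ` by at most `B`. -/
noncomputable def likelihoodVariation (B : ℝ) (θ : Env d) (l : List (Record d)) : ℝ :=
  (l.map fun z => |z.2.2 - meanDemand θ z.1 z.2.1| * B + B ^ 2 / 2).sum

theorem abs_log_likelihood_sub_le {B : ℝ} {γ θ : Env d} {l : List (Record d)}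
    (h : ∀ z ∈ l, |meanDemand (γ - θ) z.1 z.2.1| ≤ B) :
    |Real.log (likelihood l γ) - Real.log (likelihood l θ)| ≤ likelihoodVariation B θ l := by
  induction l with
  | nil => simp [likelihood, likelihoodVariation]
  | cons z l ih =>
    have hz := h z List.mem_cons_self
    have h1 : |Real.log (demandDensity γ z.1 z.2.1 z.2.2) -
        Real.log (demandDensity θ z.1 z.2.1 z.2.2)| ≤
        |z.2.2 - meanDemand θ z.1 z.2.1| * B + B ^ 2 / 2 := by
      rw [log_demandDensity_sub]
      refine (abs_sub _ _).trans (add_le_add ?_ ?_)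
      · rw [abs_mul]; gcongr
      · rw [abs_of_nonneg (by positivity), ← sq_abs]; gcongr
    have h2 := ih fun w hw => h w (List.mem_cons_of_mem z hw)
    rw [log_likelihood_cons, log_likelihood_cons, add_sub_add_comm]
    simp only [likelihoodVariation, List.map_cons, List.sum_cons]
    exact (abs_add_le _ _).trans (add_le_add h1 h2)

/-! ### Prior mass around an environment -/

variable {Γ : Set (Env d)}

theorem isProbabilityMeasure_uniformPrior (h0 : volume Γ ≠ 0) {γbar : ℝ}
    (hΓ : ∀ γ ∈ Γ, ‖γ‖ ≤ γbar) : IsProbabilityMeasure (uniformPrior Γ) := by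
  refine cond_isProbabilityMeasure_of_finite h0 ?_
  refine ((Metric.isBounded_closedBall (x := (0 : Env d)) (r := γbar)).subset
    fun γ hγ => ?_).measure_lt_top.ne
  simpa using hΓ γ hγ

/-- The homothety of ratio `s` centred at `γ₀` maps `Γ` into itself and scales volume by `s ^ (2 *
d)`, so the image has exactly this prior mass. On it, concavity of the log-likelihood limits the
drop below its value at `γ₀` to `s * R`; Markov's inequality concludes. -/
theorem pow_mul_exp_le_integral_likelihood (hconv : Convex ℝ Γ) (hmeas : MeasurableSet Γ)
    [IsProbabilityMeasure (uniformPrior Γ)] {γ₀ : Env d} (hγ₀ : γ₀ ∈ Γ)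
    {l : List (Record d)} {R : ℝ}
    (hR : ∀ γ ∈ Γ, Real.log (likelihood l γ₀) - Real.log (likelihood l γ) ≤ R)
    {s : ℝ} (hs : 0 < s) (hs1 : s ≤ 1) :
    s ^ (2 * d) * Real.exp (Real.log (likelihood l γ₀) - s * R) ≤
      ∫ γ, likelihood l γ ∂(uniformPrior Γ) := by
  set A := AffineMap.homothety γ₀ s '' Γ with hA
  have hform : ∀ γ, AffineMap.homothety γ₀ s γ = (1 - s) • γ₀ + s • γ := fun γ => by
    rw [AffineMap.homothety_apply, vsub_eq_sub, vadd_eq_add]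
    module
  have hAΓ : A ⊆ Γ := by
    rintro _ ⟨γ, hγ, rfl⟩
    rw [hform]
    exact hconv hγ₀ hγ (by linarith) hs.le (by ring)
  have hAL : A ⊆ {γ | Real.exp (Real.log (likelihood l γ₀) - s * R) ≤ likelihood l γ} := by
    rintro _ ⟨γ, hγ, rfl⟩
    rw [mem_ofPred_eq, ← Real.le_log_iff_exp_le (likelihood_pos _ _), hform]
    have h1 := (concaveOn_log_likelihood l).2 (mem_univ γ₀) (mem_univ γ)
      (by linarith : 0 ≤ 1 - s) hs.le (by ring)
    simp only [smul_eq_mul] at h1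
    nlinarith [hR γ hγ]
  have hmass : (uniformPrior Γ).real A = s ^ (2 * d) := by
    have hΓ0 : volume Γ ≠ 0 ∧ volume Γ ≠ ∞ := by
      have h1 : uniformPrior Γ univ = 1 := measure_univ
      rw [uniformPrior, cond_apply hmeas, inter_univ] at h1
      refine ⟨fun h0 => ?_, fun h0 => ?_⟩ <;> rw [h0] at h1 <;> simp at h1
    rw [measureReal_def, uniformPrior, cond_apply hmeas, inter_eq_self_of_subset_right hAΓ, hA,
      Measure.addHaar_image_homothety, finrank_euclideanSpace, Fintype.card_sum, Fintype.card_fin,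
      mul_left_comm, ENNReal.inv_mul_cancel hΓ0.1 hΓ0.2, mul_one, ENNReal.toReal_ofReal
      (abs_nonneg _), abs_of_nonneg (by positivity), two_mul]
  have h1 := mul_meas_ge_le_integral_of_nonneg
    (Filter.Eventually.of_forall fun γ => (likelihood_pos l γ).le)
    (integrable_likelihood (π := uniformPrior Γ) l)
    (Real.exp (Real.log (likelihood l γ₀) - s * R))
  rw [mul_comm, ← hmass]
  exact (mul_le_mul_of_nonneg_left (measureReal_mono hAL) (Real.exp_nonneg _)).trans h1

theorem log_likelihood_sub_log_integral_le (hconv : Convex ℝ Γ) (hmeas : MeasurableSet Γ)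
    [IsProbabilityMeasure (uniformPrior Γ)] {γ₀ : Env d} (hγ₀ : γ₀ ∈ Γ)
    {l : List (Record d)} {R : ℝ}
    (hR : ∀ γ ∈ Γ, Real.log (likelihood l γ₀) - Real.log (likelihood l γ) ≤ R)
    {s : ℝ} (hs : 0 < s) (hs1 : s ≤ 1) :
    Real.log (likelihood l γ₀) - Real.log (∫ γ, likelihood l γ ∂(uniformPrior Γ)) ≤
      2 * d * Real.log s⁻¹ + s * R := by
  have h1 := Real.log_le_log (by positivity)
    (pow_mul_exp_le_integral_likelihood hconv hmeas hγ₀ hR hs hs1)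
  rw [Real.log_mul (by positivity) (Real.exp_ne_zero _), Real.log_exp, Real.log_pow] at h1
  push_cast at h1
  rw [Real.log_inv]
  linarith

/-- The posterior mean of the squared distance to an environment `θ`, in terms of the prior mean of
the root of the likelihood ratio. -/
theorem mul_integral_posterior_sq_dist_le (hconv : Convex ℝ Γ) (hmeas : MeasurableSet Γ)
    [IsProbabilityMeasure (uniformPrior Γ)] {γbar : ℝ} (hΓ : ∀ γ ∈ Γ, ‖γ‖ ≤ γbar)
    {θ : Env d} (hθ : θ ∈ Γ) {l : List (Record d)} {R : ℝ}
    (hR : ∀ γ ∈ Γ, |Real.log (likelihood l γ) - Real.log (likelihood l θ)| ≤ R)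
    {s : ℝ} (hs : 0 < s) (hs1 : s ≤ 1) {c : ℝ} (hc : 0 ≤ c) :
    c * ∫ γ, ‖θ - γ‖ ^ 2 ∂(posterior (uniformPrior Γ) l) ≤
      ∫ γ, Real.exp ((Real.log (likelihood l γ) - Real.log (likelihood l θ)) / 2 +
        c * ‖θ - γ‖ ^ 2) ∂(uniformPrior Γ) - 1 + 2 * d * Real.log s⁻¹ + 2 * s * R := by
  set π := uniformPrior Γ with hπ
  have hπΓ : ∀ᵐ γ ∂π, γ ∈ Γ := ae_cond_mem hmeas
  have hPΓ : ∀ᵐ γ ∂(posterior π l), γ ∈ Γ := posterior_absolutelyContinuous π l hπΓ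
  have hmL := measurable_likelihood l
  set Z := ∫ γ, likelihood l γ ∂π with hZ
  have hZ0 : 0 < Z := integral_likelihood_pos l
  set G : Env d → ℝ := fun γ =>
    (Real.log (likelihood l γ) - Real.log (likelihood l θ)) / 2 + c * ‖θ - γ‖ ^ 2 with hG
  set E := 2 * d * Real.log s⁻¹ + 2 * s * R with hE
  -- The shrinking argument is run around every point of `Γ`, not only `θ`. Comparing two arbitrary
  -- points through `θ` doubles `R`.
  have hEle : ∀ γ₀ ∈ Γ, Real.log (likelihood l γ₀) - Real.log Z ≤ E := fun γ₀ hγ₀ => by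
    have h1 := log_likelihood_sub_log_integral_le hconv hmeas hγ₀ (R := 2 * R)
      (fun γ hγ => by
        have h2 := (abs_le.1 (hR γ₀ hγ₀)).2
        have h3 := (abs_le.1 (hR γ hγ)).1
        linarith) hs hs1
    linarith
  have hint : Integrable (fun γ => Real.exp (G γ - Real.log (likelihood l γ) + Real.log Z))
      (posterior π l) := by
    refine Integrable.of_bound (by fun_prop)
      (Real.exp (R / 2 + c * (‖θ‖ + γbar) ^ 2 + (R - Real.log (likelihood l θ)) + Real.log Z)) ?_
    filter_upwards [hPΓ] with γ hγ
    rw [Real.norm_eq_abs, Real.abs_exp, Real.exp_le_exp]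
    have h1 := abs_le.1 (hR γ hγ)
    have h2 : ‖θ - γ‖ ^ 2 ≤ (‖θ‖ + γbar) ^ 2 := by
      gcongr
      exact (norm_sub_le _ _).trans (by gcongr; exact hΓ γ hγ)
    have h3 := mul_le_mul_of_nonneg_left h2 hc
    simp only [hG]
    linarith
  -- Change of measure: the posterior has density `L / Z` with respect to the prior, which the
  -- correction in the exponent removes.
  have heq : ∫ γ, Real.exp (G γ - Real.log (likelihood l γ) + Real.log Z) ∂(posterior π l) =
      ∫ γ, Real.exp (G γ) ∂π := by
    rw [integral_posterior, ← integral_const_mul]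
    refine integral_congr_ae (Filter.Eventually.of_forall fun γ => ?_)
    simp only
    rw [Real.exp_add, Real.exp_sub, Real.exp_log (likelihood_pos l γ), Real.exp_log hZ0]
    have := (likelihood_pos l γ).ne'
    field_simp
    exact div_self hZ0.ne'
  have hI := integrable_norm_sub_sq hPΓ hΓ θ
  have key : ∀ᵐ γ ∂(posterior π l), c * ‖θ - γ‖ ^ 2 ≤
      Real.exp (G γ - Real.log (likelihood l γ) + Real.log Z) + (E - 1) := by
    filter_upwards [hPΓ] with γ hγ
    -- The exponent is `c ‖θ - γ‖ ^ 2` minus half of `log L γ - log Z` and half of `log L θ - log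
    -- Z`; each of these two is at most `E`.
    have h1 := Real.add_one_le_exp (G γ - Real.log (likelihood l γ) + Real.log Z)
    have h2 := hEle γ hγ
    have h3 := hEle θ hθ
    simp only [hG] at h1 ⊢
    linarith
  have h1 := integral_mono_ae (hI.const_mul c) (hint.add (integrable_const _)) key
  simp only [Pi.add_apply] at h1
  rw [integral_const_mul, integral_add hint (integrable_const _), heq] at h1
  simp only [integral_const, probReal_univ, one_smul] at h1
  linarith

end ContextualPricing

namespace ContextualPricing

variable {d : ℕ}

/-! ### Histories as measurable functions of the driving noise -/

/-- The law of the noise that drives one period. -/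
noncomputable def noiseLaw (PX : Measure (Ctx d)) (C : ℝ) (T : ℕ) : Measure (Record d) :=
  PX.prod ((gaussianReal 0 1).prod (perturbationLaw C T))

instance (PX : Measure (Ctx d)) [IsProbabilityMeasure PX] (C : ℝ) (T : ℕ) :
    IsProbabilityMeasure (noiseLaw PX C T) := by
  unfold noiseLaw; infer_instance

/-- The record of period `n`. -/
noncomputable def periodRecord (alg : List (Record d) → Ctx d → ℝ) (γ : Env d)
    (x : ℕ → Ctx d) (e δ : ℕ → ℝ) (n : ℕ) : Record d :=
  (x n, postedPrice alg γ x e δ n, meanDemand γ (x n) (postedPrice alg γ x e δ n) + e n)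

/-- The records of the first `n` periods. -/
noncomputable def pastRecords (alg : List (Record d) → Ctx d → ℝ) (γ : Env d)
    (x : ℕ → Ctx d) (e δ : ℕ → ℝ) (n : ℕ) : Fin n → Record d :=
  fun i => periodRecord alg γ x e δ i

theorem past_eq_ofFn (alg : List (Record d) → Ctx d → ℝ) (γ : Env d)
    (x : ℕ → Ctx d) (e δ : ℕ → ℝ) (n : ℕ) :
    past alg γ x e δ n = List.ofFn (pastRecords alg γ x e δ n) := by
  induction n with
  | zero => simp [past]
  | succ n ih =>
    rw [List.ofFn_succ', List.concat_eq_append, past]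
    congr 1

theorem past_succ (alg : List (Record d) → Ctx d → ℝ) (γ : Env d)
    (x : ℕ → Ctx d) (e δ : ℕ → ℝ) (n : ℕ) :
    past alg γ x e δ (n + 1) = past alg γ x e δ n ++ [periodRecord alg γ x e δ n] := rfl

/-- Factoring a record through the driving noise up to its own period gives both measurability and,
since later noises are independent of earlier ones, independence of the past from the current noise.
-/
theorem exists_measurable_periodRecord {alg : List (Record d) → Ctx d → ℝ}
    (halg : ∀ n, Measurable fun p : (Fin n → Record d) × Ctx d => alg (List.ofFn p.1) p.2)
    (γ : Env d) (n : ℕ) :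
    ∃ Ψ : (Finset.range (n + 1) → Record d) → Record d, Measurable Ψ ∧
      ∀ x e δ, periodRecord alg γ x e δ n = Ψ fun i => (x i, e i, δ i) := by
  induction n using Nat.strong_induction_on with
  | _ n ih =>
    choose Ψ hΨm hΨ using ih
    set res : (m : ℕ) → m < n → (Finset.range (n + 1) → Record d) →
        (Finset.range (m + 1) → Record d) := fun m hm w i =>
      w ⟨i, Finset.mem_range.2 ((Finset.mem_range.1 i.2).trans_le (by omega))⟩ with hres
    set Y : (Finset.range (n + 1) → Record d) → Fin n → Record d := fun w i =>
      Ψ i i.2 (res i i.2 w) with hY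
    have hYm : Measurable Y := by
      refine measurable_pi_iff.2 fun i => (hΨm i i.2).comp ?_
      exact measurable_pi_iff.2 fun j => measurable_pi_apply _
    set last : (Finset.range (n + 1) → Record d) → Record d := fun w =>
      w ⟨n, Finset.mem_range.2 n.lt_succ_self⟩
    have hlast : Measurable last := measurable_pi_apply _
    set price : (Finset.range (n + 1) → Record d) → ℝ := fun w =>
      alg (List.ofFn (Y w)) (last w).1 + (last w).2.2 with hprice
    have hpm : Measurable price := by
      have hg : Measurable fun w => (Y w, (last w).1) := hYm.prodMk hlast.fst
      have h1 : Measurable fun w => alg (List.ofFn (Y w)) (last w).1 := ((halg n).comp hg :)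
      exact h1.add hlast.snd.snd
    have hmm : Measurable fun w => meanDemand γ (last w).1 (price w) := by
      have hg : Measurable fun w => (γ, (last w).1, price w) :=
        measurable_const.prodMk (hlast.fst.prodMk hpm)
      exact (measurable_meanDemand.comp hg :)
    refine ⟨fun w => ((last w).1, price w, meanDemand γ (last w).1 (price w) + (last w).2.1),
      hlast.fst.prodMk (hpm.prodMk (hmm.add hlast.snd.fst)), fun x e δ => ?_⟩
    have h1 : pastRecords alg γ x e δ n = Y fun i => (x i, e i, δ i) := by
      funext i
      exact hΨ i i.2 x e δ
    have h2 : postedPrice alg γ x e δ n = price fun i => (x i, e i, δ i) := by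
      rw [postedPrice, past_eq_ofFn, h1]
    rw [periodRecord, h2]

section Driving

variable {Ω : Type*} [MeasurableSpace Ω] {μ : Measure Ω} {PX : Measure (Ctx d)} {C : ℝ} {T : ℕ}
  {X : ℕ → Ω → Ctx d} {ε δ : ℕ → Ω → ℝ} {alg : List (Record d) → Ctx d → ℝ}

theorem IsDrivingNoise.measurable (hW : IsDrivingNoise μ PX C T X ε δ) (n : ℕ) :
    Measurable fun ω => (X n ω, ε n ω, δ n ω) :=
  (hW.measurable_X n).prodMk ((hW.measurable_ε n).prodMk (hW.measurable_δ n))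

theorem exists_measurable_pastRecords
    (halg : ∀ n, Measurable fun p : (Fin n → Record d) × Ctx d => alg (List.ofFn p.1) p.2)
    (γ : Env d) (n : ℕ) :
    ∃ Φ : (Finset.range n → Record d) → Fin n → Record d, Measurable Φ ∧
      ∀ x e δ, pastRecords alg γ x e δ n = Φ fun i => (x i, e i, δ i) := by
  choose Ψ hΨm hΨ using exists_measurable_periodRecord halg γ
  refine ⟨fun w i => Ψ i fun j => w ⟨j, Finset.mem_range.2 ((Finset.mem_range.1 j.2).trans_le i.2)⟩,
    measurable_pi_iff.2 fun i => (hΨm i).comp (measurable_pi_iff.2 fun j => measurable_pi_apply _),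
    fun x e δ => ?_⟩
  funext i
  exact hΨ i x e δ

theorem IsDrivingNoise.measurable_pastRecords (hW : IsDrivingNoise μ PX C T X ε δ)
    (halg : ∀ n, Measurable fun p : (Fin n → Record d) × Ctx d => alg (List.ofFn p.1) p.2)
    (γ : Env d) (n : ℕ) :
    Measurable fun ω => pastRecords alg γ (X · ω) (ε · ω) (δ · ω) n := by
  obtain ⟨Φ, hΦm, hΦ⟩ := exists_measurable_pastRecords halg γ n
  simp only [hΦ]
  exact hΦm.comp (measurable_pi_iff.2 fun i => hW.measurable i)

theorem IsDrivingNoise.indepFun_pastRecords (hW : IsDrivingNoise μ PX C T X ε δ)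
    (halg : ∀ n, Measurable fun p : (Fin n → Record d) × Ctx d => alg (List.ofFn p.1) p.2)
    (γ : Env d) (n : ℕ) :
    IndepFun (fun ω => pastRecords alg γ (X · ω) (ε · ω) (δ · ω) n)
      (fun ω => (X n ω, ε n ω, δ n ω)) μ := by
  obtain ⟨Φ, hΦm, hΦ⟩ := exists_measurable_pastRecords halg γ n
  simp only [hΦ]
  have h := hW.indep.indepFun_finset (Finset.range n) {n} (by simp) hW.measurable
  exact h.comp hΦm (measurable_pi_apply (⟨n, Finset.mem_singleton_self n⟩ : ({n} : Finset ℕ)))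

theorem IsDrivingNoise.map_pastRecords_prod [IsProbabilityMeasure μ]
    (hW : IsDrivingNoise μ PX C T X ε δ)
    (halg : ∀ n, Measurable fun p : (Fin n → Record d) × Ctx d => alg (List.ofFn p.1) p.2)
    (γ : Env d) (n : ℕ) :
    μ.map (fun ω => (pastRecords alg γ (X · ω) (ε · ω) (δ · ω) n, (X n ω, ε n ω, δ n ω))) =
      (μ.map fun ω => pastRecords alg γ (X · ω) (ε · ω) (δ · ω) n).prod (noiseLaw PX C T) := by
  rw [(indepFun_iff_map_prod_eq_prod_map_map (hW.measurable_pastRecords halg γ n).aemeasurable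
    (hW.measurable n).aemeasurable).1 (hW.indepFun_pastRecords halg γ n), hW.law n, noiseLaw]

theorem IsDrivingNoise.ae_of_ae_noiseLaw (hW : IsDrivingNoise μ PX C T X ε δ)
    {p : Record d → Prop} (hp : ∀ᵐ w ∂(noiseLaw PX C T), p w) :
    ∀ᵐ ω ∂μ, ∀ n, p (X n ω, ε n ω, δ n ω) := by
  refine ae_all_iff.2 fun n => ?_
  refine ae_of_ae_map (hW.measurable n).aemeasurable ?_
  rw [hW.law n]
  exact hp

theorem ae_noiseLaw [IsProbabilityMeasure PX] {𝒳 : Set (Ctx d)} (h𝒳 : ∀ᵐ x ∂PX, x ∈ 𝒳) :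
    ∀ᵐ w ∂(noiseLaw PX C T), w.1 ∈ 𝒳 ∧ |w.2.2| = |perturbationSize C T| := by
  have h1 : ∀ᵐ w ∂(noiseLaw PX C T), w.1 ∈ 𝒳 :=
    Measure.quasiMeasurePreserving_fst.ae h𝒳
  have h2 : ∀ᵐ w ∂((gaussianReal 0 1).prod (perturbationLaw C T)),
      |w.2| = |perturbationSize C T| :=
    Measure.quasiMeasurePreserving_snd.ae (ae_abs_eq_perturbationLaw C T)
  have h3 : ∀ᵐ w ∂(noiseLaw PX C T), |w.2.2| = |perturbationSize C T| :=
    Measure.quasiMeasurePreserving_snd.ae h2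
  exact h1.and h3

end Driving

end ContextualPricing

namespace ContextualPricing

variable {d : ℕ}

/-! ### The information gathered in one period -/

/-- The Hellinger affinity of two unit Gaussians at distance `u`: the moment generating function at
`u / 2` contributes `u ^ 2 / 8` against `-u ^ 2 / 4`. -/
theorem lintegral_gaussian_sqrt_ratio (u : ℝ) :
    ∫⁻ e, ENNReal.ofReal (Real.exp ((e * u - u ^ 2 / 2) / 2)) ∂(gaussianReal 0 1) =
      ENNReal.ofReal (Real.exp (-(u ^ 2 / 8))) := by
  have hexp : ∀ e : ℝ, Real.exp ((e * u - u ^ 2 / 2) / 2) =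
      Real.exp (-(u ^ 2 / 4)) * Real.exp (u / 2 * e) := fun e => by
    rw [← Real.exp_add]; congr 1; ring
  have h := congrFun (mgf_id_gaussianReal (μ := 0) (v := 1)) (u / 2)
  simp only [mgf, id_eq] at h
  simp only [hexp]
  rw [← ofReal_integral_eq_lintegral_ofReal ((integrable_exp_mul_gaussianReal _).const_mul _)
    (Filter.Eventually.of_forall fun e => by positivity), integral_const_mul, h, ← Real.exp_add,
    NNReal.coe_one]
  congr 2
  ring

/-- From `exp (-y) ≤ 1 / (1 + y)`. A bound affine in `u ^ 2` can be averaged over contexts and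
prices, leaving only the second moment of `u` to be bounded below. -/
theorem exp_neg_sq_div_le {u B : ℝ} (h : |u| ≤ B) :
    Real.exp (-(u ^ 2 / 8)) ≤ 1 - u ^ 2 / (8 + B ^ 2) := by
  have h1 : u ^ 2 ≤ B ^ 2 := sq_le_sq' (by linarith [neg_abs_le u]) ((le_abs_self u).trans h)
  have h2 := Real.add_one_le_exp (u ^ 2 / 8)
  have h3 : Real.exp (-(u ^ 2 / 8)) ≤ (u ^ 2 / 8 + 1)⁻¹ := by
    rw [Real.exp_neg]
    exact inv_anti₀ (by positivity) h2
  have h4 : (u ^ 2 / 8 + 1)⁻¹ = 1 - u ^ 2 / (8 + u ^ 2) := by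
    field_simp
    ring
  rw [h4] at h3
  have h5 : u ^ 2 / (8 + B ^ 2) ≤ u ^ 2 / (8 + u ^ 2) := by gcongr
  linarith

/-- The rate of information in the direction of worst identifiability. -/
theorem perturbed_sq_ge {p q a σ C hi : ℝ} (hσ : σ ^ 2 ≤ C ^ 2) (ha : a ^ 2 ≤ hi ^ 2) :
    σ ^ 2 / (2 * C ^ 2 + 2 * hi ^ 2 + 1) * (p ^ 2 + q ^ 2) ≤ (p + a * q) ^ 2 + σ ^ 2 * q ^ 2 := by
  -- Write `p = (p + a q) - a q`. When `p = -a q` the price `a` reveals nothing, and only the term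
  -- `σ ^ 2 q ^ 2` due to the perturbation remains.
  have h1 : p ^ 2 ≤ 2 * (p + a * q) ^ 2 + 2 * hi ^ 2 * q ^ 2 := by
    nlinarith [sq_nonneg (p + 2 * (a * q)), mul_le_mul_of_nonneg_right ha (sq_nonneg q)]
  rw [div_mul_eq_mul_div, div_le_iff₀ (by positivity)]
  have h2 := mul_le_mul_of_nonneg_left h1 (sq_nonneg σ)
  have h3 := mul_le_mul_of_nonneg_right hσ (sq_nonneg (p + a * q))
  have h4 := mul_nonneg (sq_nonneg hi) (sq_nonneg (p + a * q))
  have h5 := mul_nonneg (sq_nonneg C) (mul_nonneg (sq_nonneg σ) (sq_nonneg q))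
  nlinarith [sq_nonneg (p + a * q)]

theorem ae_prod_perturbationLaw {PX : Measure (Ctx d)} {𝒳 : Set (Ctx d)}
    (h𝒳 : ∀ᵐ x ∂PX, x ∈ 𝒳) (C : ℝ) (T : ℕ) :
    ∀ᵐ w ∂(PX.prod (perturbationLaw C T)), w.1 ∈ 𝒳 ∧ |w.2| = |perturbationSize C T| :=
  (Measure.quasiMeasurePreserving_fst.ae h𝒳).and
    (Measure.quasiMeasurePreserving_snd.ae (ae_abs_eq_perturbationLaw C T))

variable {PX : Measure (Ctx d)} [IsProbabilityMeasure PX] {𝒳 : Set (Ctx d)}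
  {lo hi C lam Xbar : ℝ} {T : ℕ}

theorem integral_sq_inner_ge (hX : ∀ x ∈ 𝒳, ‖x‖ ≤ Xbar) (h𝒳 : ∀ᵐ x ∂PX, x ∈ 𝒳)
    (hlam : ∀ u : Ctx d, lam * ‖u‖ ^ 2 ≤ ∫ x, (inner ℝ u x) ^ 2 ∂PX) (v : Env d) :
    lam * ‖v‖ ^ 2 ≤
      ∫ x, ((inner ℝ (interceptPart v) x) ^ 2 + (inner ℝ (slopePart v) x) ^ 2) ∂PX := by
  have hint : ∀ u : Ctx d, Integrable (fun x => (inner ℝ u x : ℝ) ^ 2) PX := fun u => by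
    refine Integrable.of_bound (by fun_prop) ((‖u‖ * Xbar) ^ 2) ?_
    filter_upwards [h𝒳] with x hx
    rw [norm_pow]
    gcongr
    exact (norm_inner_le_norm u x).trans (by gcongr; exact hX x hx)
  rw [integral_add (hint _) (hint _), norm_sq_eq_parts, mul_add]
  exact add_le_add (hlam _) (hlam _)

theorem meanDemand_eq (γ : Env d) (x : Ctx d) (a : ℝ) :
    meanDemand γ x a = inner ℝ (interceptPart γ) x + a * inner ℝ (slopePart γ) x := by
  rw [meanDemand, mul_comm a]

theorem measurable_meanDemand_perturbed (v : Env d) {a : Ctx d → ℝ} (ha : Measurable a) :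
    Measurable fun w : Ctx d × ℝ => meanDemand v w.1 (a w.1 + w.2) := by
  have hg : Measurable fun w : Ctx d × ℝ => (v, w.1, a w.1 + w.2) := by fun_prop
  exact (measurable_meanDemand.comp hg :)

/-- At each context, averaging over the two signs gives `(p + a q) ^ 2 + σ ^ 2 q ^ 2`, where `p`,
`q` are the intercept and slope of `v` there. `perturbed_sq_ge` bounds this below by a multiple of
`p ^ 2 + q ^ 2`, free of the price rule, and the context average is then at least `lam * ‖v‖ ^ 2`.
-/
theorem integral_meanDemand_sq_ge (hC : 0 < C) (hT : 1 ≤ T) (hlo : 0 < lo)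
    (hX : ∀ x ∈ 𝒳, ‖x‖ ≤ Xbar) (h𝒳 : ∀ᵐ x ∂PX, x ∈ 𝒳)
    (hlam : ∀ u : Ctx d, lam * ‖u‖ ^ 2 ≤ ∫ x, (inner ℝ u x) ^ 2 ∂PX) (v : Env d)
    {a : Ctx d → ℝ} (ha : ∀ x, a x ∈ Icc lo hi)
    (hint : Integrable (fun w => meanDemand v w.1 (a w.1 + w.2) ^ 2)
      (PX.prod (perturbationLaw C T))) :
    perturbationSize C T ^ 2 / (2 * C ^ 2 + 2 * hi ^ 2 + 1) * (lam * ‖v‖ ^ 2) ≤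
      ∫ w, meanDemand v w.1 (a w.1 + w.2) ^ 2 ∂(PX.prod (perturbationLaw C T)) := by
  set k := perturbationSize C T ^ 2 / (2 * C ^ 2 + 2 * hi ^ 2 + 1) with hk
  have hσ : perturbationSize C T ^ 2 ≤ C ^ 2 := by
    gcongr
    · exact (perturbationSize_pos hC hT).le
    · exact perturbationSize_le hC hT
  have hk0 : 0 ≤ k := by positivity
  refine (mul_le_mul_of_nonneg_left (integral_sq_inner_ge hX h𝒳 hlam v) hk0).trans ?_
  rw [integral_prod _ hint, ← integral_const_mul]
  refine integral_mono_of_nonneg (Filter.Eventually.of_forall fun x => by positivity)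
    hint.integral_prod_left (Filter.Eventually.of_forall fun x => ?_)
  have h1 : (a x) ^ 2 ≤ hi ^ 2 := by
    have := ha x
    have h2 := this.1
    gcongr
    · linarith
    · exact this.2
  refine (perturbed_sq_ge hσ h1).trans (le_of_eq ?_)
  simp only [integral_perturbationLaw, meanDemand_eq]
  ring

theorem abs_meanDemand_le_of_le {x : Ctx d} (hx : ‖x‖ ≤ Xbar) {a A : ℝ} (ha : |a| ≤ A)
    {v : Env d} {V : ℝ} (hv : ‖v‖ ≤ V) : |meanDemand v x a| ≤ Xbar * (1 + A) * V := by
  have hX : 0 ≤ Xbar := (norm_nonneg x).trans hx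
  have hA : 0 ≤ A := (abs_nonneg a).trans ha
  refine (abs_meanDemand_le v x a).trans ?_
  gcongr

theorem abs_add_perturbation_le (hC : 0 < C) (hT : 1 ≤ T) (hlo : 0 < lo) {a δ : ℝ}
    (ha : a ∈ Icc lo hi) (hδ : |δ| = |perturbationSize C T|) : |a + δ| ≤ hi + C := by
  refine (abs_add_le _ _).trans (add_le_add ?_ ?_)
  · rw [abs_of_pos (hlo.trans_le ha.1)]; exact ha.2
  · rw [hδ, abs_of_pos (perturbationSize_pos hC hT)]; exact perturbationSize_le hC hT

/-- Whatever the price rule, the root of the likelihood ratio of one period contracts in mean. -/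
theorem lintegral_sqrt_ratio_le (hC : 0 < C) (hT : 1 ≤ T) (hlo : 0 < lo)
    (hX : ∀ x ∈ 𝒳, ‖x‖ ≤ Xbar) (h𝒳 : ∀ᵐ x ∂PX, x ∈ 𝒳)
    (hlam : ∀ u : Ctx d, lam * ‖u‖ ^ 2 ≤ ∫ x, (inner ℝ u x) ^ 2 ∂PX) {v : Env d} {V : ℝ}
    (hv : ‖v‖ ≤ V) {a : Ctx d → ℝ} (ham : Measurable a) (ha : ∀ x, a x ∈ Icc lo hi) :
    ∫⁻ w, ENNReal.ofReal (Real.exp ((w.2.1 * meanDemand v w.1 (a w.1 + w.2.2) -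
        meanDemand v w.1 (a w.1 + w.2.2) ^ 2 / 2) / 2)) ∂(noiseLaw PX C T) ≤
      ENNReal.ofReal (Real.exp (-(perturbationSize C T ^ 2 / (2 * C ^ 2 + 2 * hi ^ 2 + 1) * lam /
        (8 + (Xbar * (1 + (hi + C)) * V) ^ 2) * ‖v‖ ^ 2))) := by
  set B := Xbar * (1 + (hi + C)) * V with hB
  set u : Ctx d × ℝ → ℝ := fun w => meanDemand v w.1 (a w.1 + w.2) with hu
  have hum : Measurable u := measurable_meanDemand_perturbed v ham
  have huB : ∀ᵐ w ∂(PX.prod (perturbationLaw C T)), |u w| ≤ B := by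
    filter_upwards [ae_prod_perturbationLaw h𝒳 C T] with w hw
    exact abs_meanDemand_le_of_le (hX _ hw.1) (abs_add_perturbation_le hC hT hlo (ha _) hw.2) hv
  have hsq : Integrable (fun w => u w ^ 2) (PX.prod (perturbationLaw C T)) := by
    refine Integrable.of_bound (by fun_prop) (B ^ 2) ?_
    filter_upwards [huB] with w hw
    rw [norm_pow]
    gcongr
    exact hw
  have hum' : Measurable fun w : Record d => u (w.1, w.2.2) := by fun_prop
  -- The demand noise is integrated first, with context and price frozen: `u` does not depend on it.
  have h1 : ∫⁻ w, ENNReal.ofReal (Real.exp ((w.2.1 * u (w.1, w.2.2) - u (w.1, w.2.2) ^ 2 / 2) / 2))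
      ∂(noiseLaw PX C T) =
      ∫⁻ w, ENNReal.ofReal (Real.exp (-(u w ^ 2 / 8))) ∂(PX.prod (perturbationLaw C T)) := by
    rw [noiseLaw, lintegral_prod _ (by fun_prop), lintegral_prod _ (by fun_prop)]
    refine lintegral_congr fun x => ?_
    rw [lintegral_prod_symm _ (by fun_prop)]
    exact lintegral_congr fun δ => lintegral_gaussian_sqrt_ratio (u (x, δ))
  have hint : Integrable (fun w => 1 - u w ^ 2 / (8 + B ^ 2)) (PX.prod (perturbationLaw C T)) :=
    (integrable_const 1).sub (hsq.div_const _)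
  have hle : ∀ᵐ w ∂(PX.prod (perturbationLaw C T)),
      Real.exp (-(u w ^ 2 / 8)) ≤ 1 - u w ^ 2 / (8 + B ^ 2) := by
    filter_upwards [huB] with w hw using exp_neg_sq_div_le hw
  have h2 : ∫⁻ w, ENNReal.ofReal (Real.exp (-(u w ^ 2 / 8))) ∂(PX.prod (perturbationLaw C T)) ≤
      ENNReal.ofReal (∫ w, (1 - u w ^ 2 / (8 + B ^ 2)) ∂(PX.prod (perturbationLaw C T))) := by
    rw [ofReal_integral_eq_lintegral_ofReal hint
      (hle.mono fun w hw => (Real.exp_nonneg _).trans hw)]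
    exact lintegral_mono_ae (hle.mono fun w hw => ENNReal.ofReal_le_ofReal hw)
  refine h1.le.trans (h2.trans (ENNReal.ofReal_le_ofReal ?_))
  rw [integral_sub (integrable_const 1) (hsq.div_const _), integral_div]
  simp only [integral_const, probReal_univ, one_smul]
  have h3 := integral_meanDemand_sq_ge hC hT hlo hX h𝒳 hlam v ha hsq
  refine le_trans ?_ (Real.one_sub_le_exp_neg _)
  have h4 : perturbationSize C T ^ 2 / (2 * C ^ 2 + 2 * hi ^ 2 + 1) * lam /
        (8 + B ^ 2) * ‖v‖ ^ 2 =
      perturbationSize C T ^ 2 / (2 * C ^ 2 + 2 * hi ^ 2 + 1) * (lam * ‖v‖ ^ 2) / (8 + B ^ 2) := by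
    ring
  rw [h4]
  gcongr

/-! ### Contraction of the root of the likelihood ratio -/

section Driving

variable {Ω : Type*} [MeasurableSpace Ω] {μ : Measure Ω} [IsProbabilityMeasure μ]
  {X : ℕ → Ω → Ctx d} {ε δ : ℕ → Ω → ℝ} {alg : List (Record d) → Ctx d → ℝ}

theorem likelihood_append (l₁ l₂ : List (Record d)) (γ : Env d) :
    likelihood (l₁ ++ l₂) γ = likelihood l₁ γ * likelihood l₂ γ := by
  simp [likelihood]

theorem log_likelihood_past_succ_sub (θ γ : Env d) (x : ℕ → Ctx d) (e δ : ℕ → ℝ) (n : ℕ) :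
    Real.log (likelihood (past alg θ x e δ (n + 1)) γ) -
        Real.log (likelihood (past alg θ x e δ (n + 1)) θ) =
      (Real.log (likelihood (past alg θ x e δ n) γ) -
        Real.log (likelihood (past alg θ x e δ n) θ)) +
      (e n * meanDemand (γ - θ) (x n) (postedPrice alg θ x e δ n) -
        meanDemand (γ - θ) (x n) (postedPrice alg θ x e δ n) ^ 2 / 2) := by
  have h : ∀ γ', Real.log (likelihood (past alg θ x e δ (n + 1)) γ') =
      Real.log (likelihood (past alg θ x e δ n) γ') +
        Real.log (demandDensity γ' (x n) (postedPrice alg θ x e δ n)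
          (meanDemand θ (x n) (postedPrice alg θ x e δ n) + e n)) := fun γ' => by
    rw [past_succ, likelihood_append,
      Real.log_mul (likelihood_pos _ _).ne' (likelihood_pos _ _).ne']
    congr 2
    simp [likelihood, periodRecord]
  rw [h, h, add_sub_add_comm, log_demandDensity_sub]
  ring

/-- A supermartingale argument. Given the past, the price is a fixed function of the context plus
the perturbation, so the new factor of the root ratio has conditional mean at most `exp (-c ‖γ - θ‖
^ 2)`, exactly offset by the growth of the compensator. -/
theorem IsDrivingNoise.lintegral_sqrt_likelihood_ratio_le (hW : IsDrivingNoise μ PX C T X ε δ)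
    (halg : ∀ n, Measurable fun p : (Fin n → Record d) × Ctx d => alg (List.ofFn p.1) p.2)
    (halgI : ∀ l x, alg l x ∈ Icc lo hi) (hC : 0 < C) (hT : 1 ≤ T) (hlo : 0 < lo)
    (hX : ∀ x ∈ 𝒳, ‖x‖ ≤ Xbar) (h𝒳 : ∀ᵐ x ∂PX, x ∈ 𝒳)
    (hlam : ∀ u : Ctx d, lam * ‖u‖ ^ 2 ≤ ∫ x, (inner ℝ u x) ^ 2 ∂PX) {θ γ : Env d} {V c : ℝ}
    (hv : ‖γ - θ‖ ≤ V)
    (hc : c = perturbationSize C T ^ 2 / (2 * C ^ 2 + 2 * hi ^ 2 + 1) * lam /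
        (8 + (Xbar * (1 + (hi + C)) * V) ^ 2)) (n : ℕ) :
    ∫⁻ ω, ENNReal.ofReal (Real.exp
        ((Real.log (likelihood (past alg θ (X · ω) (ε · ω) (δ · ω) n) γ) -
          Real.log (likelihood (past alg θ (X · ω) (ε · ω) (δ · ω) n) θ)) / 2 +
        n * c * ‖θ - γ‖ ^ 2)) ∂μ ≤ 1 := by
  induction n with
  | zero => simp [past, likelihood]
  | succ n ih =>
    set Y : Ω → Fin n → Record d := fun ω => pastRecords alg θ (X · ω) (ε · ω) (δ · ω) n with hY
    have hYm : Measurable Y := hW.measurable_pastRecords halg θ n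
    set F : (Fin n → Record d) → ℝ := fun y =>
      (Real.log (likelihood (List.ofFn y) γ) - Real.log (likelihood (List.ofFn y) θ)) / 2 +
        n * c * ‖θ - γ‖ ^ 2 with hF
    have hL : ∀ γ' : Env d, Measurable fun y : Fin n → Record d =>
        likelihood (List.ofFn y) γ' := fun γ' => by
      have hg : Measurable fun y : Fin n → Record d => (y, γ') := by fun_prop
      exact (measurable_likelihood_ofFn n |>.comp hg :)
    have hFm : Measurable F := (((hL γ).log.sub (hL θ).log).div_const _).add_const _
    set u : (Fin n → Record d) × Record d → ℝ := fun p =>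
      meanDemand (γ - θ) p.2.1 (alg (List.ofFn p.1) p.2.1 + p.2.2.2) with hu
    have hum : Measurable u := by
      have hg : Measurable fun p : (Fin n → Record d) × Record d => (p.1, p.2.1) := by fun_prop
      have h1 : Measurable fun p : (Fin n → Record d) × Record d => alg (List.ofFn p.1) p.2.1 :=
        ((halg n).comp hg :)
      have hg' : Measurable fun p : (Fin n → Record d) × Record d =>
        (γ - θ, p.2.1, alg (List.ofFn p.1) p.2.1 + p.2.2.2) :=
        measurable_const.prodMk (measurable_snd.fst.prodMk (h1.add measurable_snd.snd.snd))
      exact (measurable_meanDemand.comp hg' :)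
    set J : (Fin n → Record d) × Record d → ℝ≥0∞ := fun p =>
      ENNReal.ofReal (Real.exp (F p.1)) * (ENNReal.ofReal (Real.exp (c * ‖θ - γ‖ ^ 2)) *
        ENNReal.ofReal (Real.exp ((p.2.2.1 * u p - u p ^ 2 / 2) / 2))) with hJ
    have hJm : Measurable J := by fun_prop
    have hstep : ∀ ω, ENNReal.ofReal (Real.exp
        ((Real.log (likelihood (past alg θ (X · ω) (ε · ω) (δ · ω) (n + 1)) γ) -
          Real.log (likelihood (past alg θ (X · ω) (ε · ω) (δ · ω) (n + 1)) θ)) / 2 +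
        (n + 1 : ℕ) * c * ‖θ - γ‖ ^ 2)) =
        J (Y ω, (X n ω, ε n ω, δ n ω)) := fun ω => by
      rw [log_likelihood_past_succ_sub, postedPrice, past_eq_ofFn]
      simp only [hJ]
      rw [← ENNReal.ofReal_mul (Real.exp_nonneg _), ← Real.exp_add,
        ← ENNReal.ofReal_mul (Real.exp_nonneg _), ← Real.exp_add]
      congr 2
      push_cast
      simp only [hF, hu, hY]
      ring
    -- Past and fresh noise have a product law, so conditioning on the past becomes an iterated
    -- integral.
    rw [lintegral_congr hstep, ← lintegral_map hJm (hYm.prodMk (hW.measurable n)),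
      hW.map_pastRecords_prod halg θ n]
    have : IsProbabilityMeasure (μ.map Y) := Measure.isProbabilityMeasure_map hYm.aemeasurable
    rw [lintegral_prod _ hJm.aemeasurable]
    have ih' : ∫⁻ y, ENNReal.ofReal (Real.exp (F y)) ∂(μ.map Y) ≤ 1 := by
      rw [lintegral_map (by fun_prop) hYm]
      simpa only [past_eq_ofFn] using ih
    refine le_trans (lintegral_mono fun y => ?_) ih'
    have hg : Measurable fun x : Ctx d => (y, x) := by fun_prop
    have ham : Measurable fun x => alg (List.ofFn y) x := ((halg n).comp hg :)
    have h1 := lintegral_sqrt_ratio_le hC hT hlo hX h𝒳 hlam hv ham (halgI (List.ofFn y))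
    rw [← hc] at h1
    simp only [hJ]
    rw [lintegral_const_mul _ (by fun_prop), lintegral_const_mul _ (by fun_prop)]
    refine mul_le_of_le_one_right (by simp) ?_
    refine (mul_le_mul_right h1 _).trans (le_of_eq ?_)
    rw [← ENNReal.ofReal_mul (Real.exp_nonneg _), ← Real.exp_add, norm_sub_rev θ γ]
    simp

end Driving

end ContextualPricing

namespace ContextualPricing

variable {d : ℕ} {Ω : Type*} [MeasurableSpace Ω] {μ : Measure Ω}
  {PX : Measure (Ctx d)} {𝒳 : Set (Ctx d)}
  {lo hi C lam Xbar γbar : ℝ} {T : ℕ} {Γ : Set (Env d)}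
  {X : ℕ → Ω → Ctx d} {ε δ : ℕ → Ω → ℝ} {alg : List (Record d) → Ctx d → ℝ}

/-! ### Concentration of the posterior -/

/-- Tonelli, with integrability as a by-product. Where the inner integral diverges, its real value
is 0 and the comparison with the lower integral still points the right way. -/
theorem integral_integral_le_one {α β : Type*} [MeasurableSpace α] [MeasurableSpace β]
    {κ : Measure α} {ν : Measure β} [IsProbabilityMeasure κ] [IsProbabilityMeasure ν]
    {f : α → β → ℝ} (hf0 : ∀ a b, 0 ≤ f a b) (hfm : Measurable fun p : α × β => f p.1 p.2)
    (h : ∀ᵐ b ∂ν, ∫⁻ a, ENNReal.ofReal (f a b) ∂κ ≤ 1) :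
    Integrable (fun a => ∫ b, f a b ∂ν) κ ∧ ∫ a, ∫ b, f a b ∂ν ∂κ ≤ 1 := by
  have hF0 : ∀ a, 0 ≤ ∫ b, f a b ∂ν := fun a => integral_nonneg (hf0 a)
  have hFm : Measurable fun a => ∫ b, f a b ∂ν :=
    hfm.stronglyMeasurable.integral_prod_right.measurable
  have hle : ∫⁻ a, ENNReal.ofReal (∫ b, f a b ∂ν) ∂κ ≤ 1 := by
    calc ∫⁻ a, ENNReal.ofReal (∫ b, f a b ∂ν) ∂κ
        ≤ ∫⁻ a, ∫⁻ b, ENNReal.ofReal (f a b) ∂ν ∂κ := by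
          refine lintegral_mono fun a => ?_
          have hm : Measurable (f a) := (hfm.comp (measurable_prodMk_left (x := a)) :)
          rw [integral_eq_lintegral_of_nonneg_ae (Filter.Eventually.of_forall (hf0 a))
            hm.aestronglyMeasurable]
          exact ENNReal.ofReal_toReal_le
      _ = ∫⁻ b, ∫⁻ a, ENNReal.ofReal (f a b) ∂κ ∂ν :=
          lintegral_lintegral_swap hfm.ennreal_ofReal.aemeasurable
      _ ≤ ∫⁻ _, 1 ∂ν := lintegral_mono_ae h
      _ = 1 := by simp
  refine ⟨⟨hFm.aestronglyMeasurable, ?_⟩, ?_⟩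
  · rw [hasFiniteIntegral_iff_ofReal (Filter.Eventually.of_forall hF0)]
    exact hle.trans_lt ENNReal.one_lt_top
  · rw [integral_eq_lintegral_of_nonneg_ae (Filter.Eventually.of_forall hF0)
      hFm.aestronglyMeasurable]
    exact ENNReal.toReal_le_of_le_ofReal zero_le_one (by simpa using hle)

/-- Under the true environment the residuals are the noises themselves, so the bound no longer
involves the adaptively chosen prices and its mean is linear in `n`. -/
theorem likelihoodVariation_past (B : ℝ) (θ : Env d) (x : ℕ → Ctx d) (e δ : ℕ → ℝ) (n : ℕ) :
    likelihoodVariation B θ (past alg θ x e δ n) =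
      ∑ i ∈ Finset.range n, (|e i| * B + B ^ 2 / 2) := by
  induction n with
  | zero => simp [past, likelihoodVariation]
  | succ n ih =>
    rw [Finset.sum_range_succ, ← ih, past_succ]
    simp [likelihoodVariation, periodRecord]

theorem abs_log_likelihood_past_sub_le (hC : 0 < C) (hT : 1 ≤ T) (hlo : 0 < lo)
    (halgI : ∀ l x, alg l x ∈ Icc lo hi) (hX : ∀ x ∈ 𝒳, ‖x‖ ≤ Xbar) {θ γ : Env d} {V : ℝ}
    (hv : ‖γ - θ‖ ≤ V) {x : ℕ → Ctx d} {e δ : ℕ → ℝ}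
    (hx : ∀ n, x n ∈ 𝒳 ∧ |δ n| = |perturbationSize C T|) (n : ℕ) :
    |Real.log (likelihood (past alg θ x e δ n) γ) -
        Real.log (likelihood (past alg θ x e δ n) θ)| ≤
      ∑ i ∈ Finset.range n,
        (|e i| * (Xbar * (1 + (hi + C)) * V) + (Xbar * (1 + (hi + C)) * V) ^ 2 / 2) := by
  rw [← likelihoodVariation_past (alg := alg) _ θ x e δ n]
  refine abs_log_likelihood_sub_le fun z hz => ?_
  rw [past_eq_ofFn, List.mem_ofFn] at hz
  obtain ⟨i, rfl⟩ := hz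
  exact abs_meanDemand_le_of_le (hX _ (hx i).1)
    (abs_add_perturbation_le hC hT hlo (halgI _ _) (hx i).2) hv

theorem IsDrivingNoise.measurable_integral_posterior_past (hW : IsDrivingNoise μ PX C T X ε δ)
    {π : Measure (Env d)} [IsProbabilityMeasure π]
    (halg : ∀ n, Measurable fun p : (Fin n → Record d) × Ctx d => alg (List.ofFn p.1) p.2)
    (θ : Env d) (n : ℕ) :
    Measurable fun ω =>
      ∫ γ, ‖θ - γ‖ ^ 2 ∂(posterior π (past alg θ (X · ω) (ε · ω) (δ · ω) n)) := by
  simp only [past_eq_ofFn]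
  exact measurable_integral_posterior (hW.measurable_pastRecords halg θ n) (by fun_prop)

theorem integral_posterior_sq_dist_mem {π : Measure (Env d)} [IsProbabilityMeasure π]
    (hπ : ∀ᵐ γ ∂π, γ ∈ Γ) (hΓ : ∀ γ ∈ Γ, ‖γ‖ ≤ γbar) {θ : Env d} (hθ : θ ∈ Γ)
    (l : List (Record d)) :
    ∫ γ, ‖θ - γ‖ ^ 2 ∂(posterior π l) ∈ Icc 0 ((2 * γbar) ^ 2) := by
  have hP := posterior_absolutelyContinuous π l hπ
  refine ⟨integral_nonneg fun γ => by positivity, ?_⟩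
  have h1 := integral_mono_ae (integrable_norm_sub_sq hP hΓ θ)
    (integrable_const ((2 * γbar) ^ 2)) (by
      filter_upwards [hP] with γ hγ
      gcongr
      exact (norm_sub_le _ _).trans (by linarith [hΓ θ hθ, hΓ γ hγ]))
  simpa using h1

variable [IsProbabilityMeasure PX]

theorem IsDrivingNoise.map_ε (hW : IsDrivingNoise μ PX C T X ε δ) (n : ℕ) :
    μ.map (ε n) = gaussianReal 0 1 := by
  have h : ε n = (fun w : Record d => w.2.1) ∘ fun ω => (X n ω, ε n ω, δ n ω) := rfl
  rw [h, ← Measure.map_map (by fun_prop) (hW.measurable n), hW.law n]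
  have h2 : (fun w : Record d => w.2.1) = Prod.fst ∘ Prod.snd := rfl
  rw [h2, ← Measure.map_map (by fun_prop) (by fun_prop), Measure.map_snd_prod, measure_univ, one_smul,
    Measure.map_fst_prod, measure_univ, one_smul]

theorem IsDrivingNoise.integrable_abs_ε (hW : IsDrivingNoise μ PX C T X ε δ) (n : ℕ) :
    Integrable (fun ω => |ε n ω|) μ := by
  have h : Integrable (fun e : ℝ => e) (μ.map (ε n)) := by
    rw [hW.map_ε]
    exact (memLp_id_gaussianReal (μ := 0) (v := 1) 1).integrable le_rfl
  exact (h.comp_measurable (hW.measurable_ε n)).abs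

theorem IsDrivingNoise.integral_abs_ε (hW : IsDrivingNoise μ PX C T X ε δ) (n : ℕ) :
    ∫ ω, |ε n ω| ∂μ = ∫ e, |e| ∂(gaussianReal 0 1) := by
  rw [← hW.map_ε n, integral_map (hW.measurable_ε n).aemeasurable (by fun_prop)]

variable [IsProbabilityMeasure μ]

/-- The rate of concentration: the expectation of the pathwise bound
`mul_integral_posterior_sq_dist_le` with weight `n * c`, the exponential term being controlled by
the supermartingale bound averaged over the prior. -/
theorem IsDrivingNoise.integral_posterior_sq_dist_le (hW : IsDrivingNoise μ PX C T X ε δ)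
    (halg : ∀ n, Measurable fun p : (Fin n → Record d) × Ctx d => alg (List.ofFn p.1) p.2)
    (halgI : ∀ l x, alg l x ∈ Icc lo hi) (hC : 0 < C) (hT : 1 ≤ T) (hlo : 0 < lo)
    (hX : ∀ x ∈ 𝒳, ‖x‖ ≤ Xbar) (h𝒳 : ∀ᵐ x ∂PX, x ∈ 𝒳)
    (hlam : ∀ u : Ctx d, lam * ‖u‖ ^ 2 ≤ ∫ x, (inner ℝ u x) ^ 2 ∂PX) (hlam0 : 0 < lam)
    (hconv : Convex ℝ Γ) (hmeas : MeasurableSet Γ) [IsProbabilityMeasure (uniformPrior Γ)]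
    (hΓ : ∀ γ ∈ Γ, ‖γ‖ ≤ γbar) {θ : Env d} (hθ : θ ∈ Γ) {B c : ℝ}
    (hB : B = Xbar * (1 + (hi + C)) * (2 * γbar))
    (hc : c = perturbationSize C T ^ 2 / (2 * C ^ 2 + 2 * hi ^ 2 + 1) * lam / (8 + B ^ 2))
    {n : ℕ} (hn : 1 ≤ n) :
    ∫ ω, (∫ γ, ‖θ - γ‖ ^ 2 ∂(posterior (uniformPrior Γ)
        (past alg θ (X · ω) (ε · ω) (δ · ω) n))) ∂μ ≤
      (2 * d * Real.log n + (2 * B * ∫ e, |e| ∂(gaussianReal 0 1) + B ^ 2)) / (n * c) := by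
  set π := uniformPrior Γ with hπ
  have hπΓ : ∀ᵐ γ ∂π, γ ∈ Γ := ae_cond_mem hmeas
  set Q : Ω → ℝ := fun ω =>
    ∫ γ, ‖θ - γ‖ ^ 2 ∂(posterior π (past alg θ (X · ω) (ε · ω) (δ · ω) n)) with hQ
  set G : Ω → Env d → ℝ := fun ω γ =>
    (Real.log (likelihood (past alg θ (X · ω) (ε · ω) (δ · ω) n) γ) -
      Real.log (likelihood (past alg θ (X · ω) (ε · ω) (δ · ω) n) θ)) / 2 +
      n * c * ‖θ - γ‖ ^ 2 with hG
  set R : Ω → ℝ := fun ω => ∑ i ∈ Finset.range n, (|ε i ω| * B + B ^ 2 / 2) with hR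
  have hn0 : (0 : ℝ) < n := by exact_mod_cast hn
  have hσ := perturbationSize_pos hC hT
  have hc0 : 0 < c := by rw [hc]; positivity
  have hdist : ∀ γ ∈ Γ, ‖γ - θ‖ ≤ 2 * γbar := fun γ hγ =>
    (norm_sub_le _ _).trans (by linarith [hΓ θ hθ, hΓ γ hγ])
  have hYm := hW.measurable_pastRecords halg θ n
  have hGm : Measurable fun p : Ω × Env d => G p.1 p.2 := by
    have hL : ∀ g : Ω × Env d → Env d, Measurable g → Measurable fun p : Ω × Env d =>
        likelihood (past alg θ (X · p.1) (ε · p.1) (δ · p.1) n) (g p) := fun g hg => by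
      simp only [past_eq_ofFn]
      have h1 : Measurable fun p : Ω × Env d =>
          (pastRecords alg θ (X · p.1) (ε · p.1) (δ · p.1) n, g p) :=
        (hYm.comp measurable_fst).prodMk hg
      exact (measurable_likelihood_ofFn n |>.comp h1 :)
    have h1 := hL _ measurable_snd
    have h2 := hL _ (measurable_const (a := θ))
    exact ((h1.log.sub h2.log).div_const _).add (by fun_prop)
  -- the prior mean of the root of the likelihood ratio
  set F : Ω → ℝ := fun ω => ∫ γ, Real.exp (G ω γ) ∂π with hF
  have hexpm : Measurable fun p : Ω × Env d => Real.exp (G p.1 p.2) := hGm.exp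
  obtain ⟨hFint, hF1⟩ : Integrable F μ ∧ ∫ ω, F ω ∂μ ≤ 1 := by
    refine integral_integral_le_one (f := fun ω γ => Real.exp (G ω γ))
      (fun ω γ => Real.exp_nonneg _) hexpm ?_
    filter_upwards [hπΓ] with γ hγ
    have h1 : c = perturbationSize C T ^ 2 / (2 * C ^ 2 + 2 * hi ^ 2 + 1) * lam /
        (8 + (Xbar * (1 + (hi + C)) * (2 * γbar)) ^ 2) := by rw [hc, hB]
    exact hW.lintegral_sqrt_likelihood_ratio_le halg halgI hC hT hlo hX h𝒳 hlam (hdist γ hγ) h1 n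
  have hεint : ∀ i, Integrable (fun ω => |ε i ω| * B + B ^ 2 / 2) μ := fun i =>
    ((hW.integrable_abs_ε i).mul_const B).add (integrable_const _)
  have hRint : Integrable R μ := integrable_finsetSum _ fun i _ => hεint i
  have hR1 : ∫ ω, R ω ∂μ = n * (B * (∫ e, |e| ∂(gaussianReal 0 1)) + B ^ 2 / 2) := by
    simp only [hR]
    rw [integral_finsetSum _ fun i _ => hεint i]
    have h1 : ∀ i ∈ Finset.range n, ∫ ω, (|ε i ω| * B + B ^ 2 / 2) ∂μ =
        B * (∫ e, |e| ∂(gaussianReal 0 1)) + B ^ 2 / 2 := fun i _ => by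
      rw [integral_add ((hW.integrable_abs_ε i).mul_const B) (integrable_const _),
        integral_mul_const, hW.integral_abs_ε]
      simp [mul_comm]
    rw [Finset.sum_congr rfl h1, Finset.sum_const, Finset.card_range, nsmul_eq_mul]
  have hQm : Measurable Q := hW.measurable_integral_posterior_past halg θ n
  have hQint : Integrable Q μ := Integrable.of_mem_Icc 0 ((2 * γbar) ^ 2) hQm.aemeasurable
    (Filter.Eventually.of_forall fun ω => integral_posterior_sq_dist_mem hπΓ hΓ hθ _)
  have key : ∀ᵐ ω ∂μ, n * c * Q ω ≤
      F ω + (2 / n) * R ω + (2 * d * Real.log n - 1) := by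
    filter_upwards [hW.ae_of_ae_noiseLaw (ae_noiseLaw h𝒳)] with ω hω
    have hvar : ∀ γ ∈ Γ, |Real.log (likelihood (past alg θ (X · ω) (ε · ω) (δ · ω) n) γ) -
        Real.log (likelihood (past alg θ (X · ω) (ε · ω) (δ · ω) n) θ)| ≤ R ω := fun γ hγ => by
      have h1 := abs_log_likelihood_past_sub_le (alg := alg) (e := (ε · ω)) hC hT hlo halgI hX
        (hdist γ hγ) hω n
      rw [← hB] at h1
      exact h1
    -- The ratio `1 / n` balances the two costs: the volume term becomes `2 d log n`, and `R`, a sum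
    -- of `n` terms, is divided by `n`.
    have h2 := mul_integral_posterior_sq_dist_le hconv hmeas hΓ hθ hvar
      (s := (n : ℝ)⁻¹) (by positivity) (inv_le_one_of_one_le₀ (by exact_mod_cast hn))
      (c := n * c) (by positivity)
    rw [inv_inv] at h2
    have h3 : 2 * (n : ℝ)⁻¹ * R ω = 2 / n * R ω := by ring
    simp only [hQ, hF, hG]
    linarith
  have hsum : Integrable (fun ω => F ω + 2 / n * R ω) μ :=
    hFint.add (hRint.const_mul (2 / (n : ℝ)))
  have h1 := integral_mono_ae (hQint.const_mul (n * c)) (hsum.add (integrable_const _)) key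
  simp only [Pi.add_apply] at h1
  rw [integral_const_mul, integral_add hsum (integrable_const _), integral_add hFint (hRint.const_mul (2 / (n : ℝ))), integral_const_mul, hR1] at h1
  simp only [integral_const, probReal_univ, one_smul] at h1
  rw [le_div_iff₀ (by positivity)]
  have h2 : 2 / (n : ℝ) * (n * (B * (∫ e, |e| ∂(gaussianReal 0 1)) + B ^ 2 / 2)) =
      2 * B * (∫ e, |e| ∂(gaussianReal 0 1)) + B ^ 2 := by
    field_simp
  rw [h2] at h1
  -- The exponential term has mean at most 1, which cancels the `-1` coming from `1 + x ≤ exp x`.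
  nlinarith [h1]

end ContextualPricing

namespace ContextualPricing

variable {d : ℕ} {Ω : Type*} [MeasurableSpace Ω] {μ : Measure Ω} {PX : Measure (Ctx d)}
  {𝒳 : Set (Ctx d)} {lo hi C lam Xbar γbar b : ℝ} {T : ℕ} {Γ : Set (Env d)}
  {X : ℕ → Ω → Ctx d} {ε δ : ℕ → Ω → ℝ} {alg : List (Record d) → Ctx d → ℝ}

/-! ### The assumptions on the environments and the observations -/

theorem abs_le_of_mem_perturbed (hC : 0 < C) (hT : 1 ≤ T) (hlo : 0 < lo) (h : lo ≤ hi) {a : ℝ}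
    (ha : a ∈ Icc (lo - perturbationSize C T) (hi + perturbationSize C T)) : |a| ≤ hi + C := by
  have h1 := perturbationSize_le hC hT
  exact abs_le.2 ⟨by linarith [ha.1], by linarith [ha.2]⟩

theorem abs_expectedRevenue_le {x : Ctx d} (hx : ‖x‖ ≤ Xbar) {a A : ℝ} (ha : |a| ≤ A)
    {γ : Env d} (hγ : ‖γ‖ ≤ γbar) : |expectedRevenue γ x a| ≤ Xbar * (1 + A) * γbar * A := by
  rw [expectedRevenue, abs_mul]
  have h1 := abs_meanDemand_le_of_le hx ha hγ
  exact mul_le_mul h1 ha (abs_nonneg a) ((abs_nonneg _).trans h1)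

theorem environmentAssumption (hC : 0 < C) (hT : 1 ≤ T) (hlo : 0 < lo) (h : lo ≤ hi)
    (hX : ∀ x ∈ 𝒳, ‖x‖ ≤ Xbar) (h0 : volume Γ ≠ 0) (hΓ : ∀ γ ∈ Γ, ‖γ‖ ≤ γbar) :
    EnvironmentAssumption Γ (uniformPrior Γ) 𝒳
      (Icc (lo - perturbationSize C T) (hi + perturbationSize C T)) γbar
      (Xbar * (1 + (hi + C)) * γbar * (hi + C)) where
  norm_le := hΓ
  reward_le x hx _ ha γ hγ := (le_abs_self _).trans
    (abs_expectedRevenue_le (hX x hx) (abs_le_of_mem_perturbed hC hT hlo h ha) (hΓ γ hγ))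
  uniform := ⟨isProbabilityMeasure_uniformPrior h0 hΓ, rfl⟩

theorem observationAssumption (hC : 0 < C) (hT : 1 ≤ T) (hlo : 0 < lo) (h : lo ≤ hi)
    (hX : ∀ x ∈ 𝒳, ‖x‖ ≤ Xbar) (hconv : Convex ℝ Γ) :
    ObservationAssumption Γ 𝒳 (Icc (lo - perturbationSize C T) (hi + perturbationSize C T))
      infoMatrix (√2) (((Xbar * (1 + (hi + C))) ^ 2) ^ 2) where
  posSemidef x _ a _ := posSemidef_infoMatrix x a
  le_klDiv x _ a _ γ _ γ' _ := by
    rw [matrixSeminorm_infoMatrix_sq]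
    exact le_klDiv_demandLaw γ γ' x a
  subGaussian x _ a _ γ _ γ' _ := by
    refine hasSubgaussianMGF_logRatio γ γ' x a ?_
    -- The factor `√2` undoes the `½` of the information matrix, leaving the exact variance `u ^ 2`.
    rw [Real.coe_toNNReal _ (by positivity), mul_pow, matrixSeminorm_infoMatrix_sq,
      Real.sq_sqrt (by norm_num)]
    ring
  concave x _ a _ D := concaveOn_log_demandDensity hconv x a D
  smooth x hx a ha D := by
    refine ⟨contDiff_log_demandDensity x a D, fun γ _ => ?_⟩
    have h1 := abs_le_of_mem_perturbed hC hT hlo h ha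
    have h2 := hX x hx
    have h3 : ‖featureVec x a‖ ≤ Xbar * (1 + (hi + C)) :=
      (norm_featureVec_le x a).trans
        (mul_le_mul h2 (by linarith) (by positivity) ((norm_nonneg x).trans h2))
    have h4 := norm_fderiv_fderiv_log_demandDensity_le x a D γ
    gcongr
    exact h4.trans (by gcongr)

theorem rewardGapAssumption (hlo : 0 < lo) (h : lo ≤ hi) (hb : 0 < b)
    (hX : ∀ x ∈ 𝒳, ‖x‖ ≤ Xbar) (hmeas : MeasurableSet Γ)
    [IsProbabilityMeasure (uniformPrior Γ)] (hΓ : ∀ γ ∈ Γ, ‖γ‖ ≤ γbar)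
    (hslope : ∀ γ ∈ Γ, ∀ x ∈ 𝒳, inner ℝ (slopePart γ) x ≤ -b) (C : ℝ) (T : ℕ) :
    RewardGapAssumption Γ (uniformPrior Γ) 𝒳 lo hi C T (Xbar * γbar * C ^ 2 / √(T : ℝ))
      ((Xbar * (1 + 2 * hi)) ^ 2 / (4 * b)) where
  exploit γ hγ l x hx := by
    rw [integral_tfLaw]
    · exact integral_perturbation_loss_le (hΓ γ hγ) (hX x hx) _ C T
    · simp only [expectedRevenue_eq]
      fun_prop
  posteriorGap γ hγ l x hx :=
    posterior_gap_le (π := uniformPrior Γ) hlo h (ae_cond_mem hmeas) hΓ hb (hX x hx) (fun γ' hγ' => hslope γ' hγ' x hx)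
      hγ l

/-! ### The regret -/

theorem IsDrivingNoise.measurable_alg_past (hW : IsDrivingNoise μ PX C T X ε δ)
    (halg : ∀ n, Measurable fun p : (Fin n → Record d) × Ctx d => alg (List.ofFn p.1) p.2)
    (θ : Env d) (n : ℕ) :
    Measurable fun ω => alg (past alg θ (X · ω) (ε · ω) (δ · ω) n) (X n ω) := by
  simp only [past_eq_ofFn]
  exact ((halg n).comp ((hW.measurable_pastRecords halg θ n).prodMk (hW.measurable_X n)) :)

variable [IsProbabilityMeasure PX] [IsProbabilityMeasure μ]

/-- The perturbation is independent of the past and of the current context, which fix the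
unperturbed price; conditioning on both reduces the claim to the one-step loss. -/
theorem IsDrivingNoise.integral_exploration_loss_le (hW : IsDrivingNoise μ PX C T X ε δ)
    (halg : ∀ n, Measurable fun p : (Fin n → Record d) × Ctx d => alg (List.ofFn p.1) p.2)
    (halgI : ∀ l x, alg l x ∈ Icc lo hi) (hC : 0 < C) (hT : 1 ≤ T) (hlo : 0 < lo)
    (hX : ∀ x ∈ 𝒳, ‖x‖ ≤ Xbar) (h𝒳 : ∀ᵐ x ∂PX, x ∈ 𝒳) {θ : Env d} (hθ : ‖θ‖ ≤ γbar) (n : ℕ) :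
    Integrable (fun ω =>
        expectedRevenue θ (X n ω) (alg (past alg θ (X · ω) (ε · ω) (δ · ω) n) (X n ω)) -
          expectedRevenue θ (X n ω) (postedPrice alg θ (X · ω) (ε · ω) (δ · ω) n)) μ ∧
      ∫ ω, (expectedRevenue θ (X n ω) (alg (past alg θ (X · ω) (ε · ω) (δ · ω) n) (X n ω)) -
          expectedRevenue θ (X n ω) (postedPrice alg θ (X · ω) (ε · ω) (δ · ω) n)) ∂μ ≤
        Xbar * γbar * C ^ 2 / √(T : ℝ) := by
  set Y : Ω → Fin n → Record d := fun ω => pastRecords alg θ (X · ω) (ε · ω) (δ · ω) n with hY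
  have hYm : Measurable Y := hW.measurable_pastRecords halg θ n
  set f : (Fin n → Record d) × Record d → ℝ := fun p =>
    expectedRevenue θ p.2.1 (alg (List.ofFn p.1) p.2.1) -
      expectedRevenue θ p.2.1 (alg (List.ofFn p.1) p.2.1 + p.2.2.2) with hf
  have hfm : Measurable f := by
    have hg : Measurable fun p : (Fin n → Record d) × Record d => (p.1, p.2.1) := by fun_prop
    have h1 : Measurable fun p : (Fin n → Record d) × Record d => alg (List.ofFn p.1) p.2.1 :=
      ((halg n).comp hg :)
    have h2 : Measurable fun p : (Fin n → Record d) × Record d =>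
        (θ, p.2.1, alg (List.ofFn p.1) p.2.1) :=
      measurable_const.prodMk (measurable_snd.fst.prodMk h1)
    have h3 : Measurable fun p : (Fin n → Record d) × Record d =>
        (θ, p.2.1, alg (List.ofFn p.1) p.2.1 + p.2.2.2) :=
      measurable_const.prodMk (measurable_snd.fst.prodMk (h1.add measurable_snd.snd.snd))
    exact (measurable_expectedRevenue.comp h2 :).sub (measurable_expectedRevenue.comp h3 :)
  have : IsProbabilityMeasure (μ.map Y) := Measure.isProbabilityMeasure_map hYm.aemeasurable
  have heq : ∀ ω, expectedRevenue θ (X n ω) (alg (past alg θ (X · ω) (ε · ω) (δ · ω) n) (X n ω)) -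
      expectedRevenue θ (X n ω) (postedPrice alg θ (X · ω) (ε · ω) (δ · ω) n) =
      f (Y ω, (X n ω, ε n ω, δ n ω)) := fun ω => by
    rw [postedPrice, past_eq_ofFn]
  simp only [heq]
  have hpair : Measurable fun ω => (Y ω, (X n ω, ε n ω, δ n ω)) := hYm.prodMk (hW.measurable n)
  set M := Xbar * (1 + (hi + C)) * γbar * (hi + C) with hM
  have hbound : ∀ l, ∀ x ∈ 𝒳, ∀ s : ℝ, |s| = |perturbationSize C T| →
      |expectedRevenue θ x (alg l x) - expectedRevenue θ x (alg l x + s)| ≤ M + M := by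
    intro l x hx s hs
    have h1 : |alg l x| ≤ hi + C := by
      rw [abs_of_pos (hlo.trans_le (halgI l x).1)]
      linarith [(halgI l x).2]
    exact (abs_sub _ _).trans (add_le_add (abs_expectedRevenue_le (hX x hx) h1 hθ)
      (abs_expectedRevenue_le (hX x hx) (abs_add_perturbation_le hC hT hlo (halgI l x) hs) hθ))
  have hint : Integrable (fun ω => f (Y ω, (X n ω, ε n ω, δ n ω))) μ := by
    refine Integrable.of_bound (hfm.comp hpair).aestronglyMeasurable (M + M) ?_
    filter_upwards [hW.ae_of_ae_noiseLaw (ae_noiseLaw h𝒳)] with ω hω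
    exact hbound _ _ (hω n).1 _ (hω n).2
  refine ⟨hint, ?_⟩
  have hint' : Integrable f ((μ.map Y).prod (noiseLaw PX C T)) := by
    rw [← hW.map_pastRecords_prod halg θ n, integrable_map_measure hfm.aestronglyMeasurable
      hpair.aemeasurable]
    exact hint
  rw [← integral_map hpair.aemeasurable hfm.aestronglyMeasurable,
    hW.map_pastRecords_prod halg θ n, integral_prod _ hint']
  have hinner : ∀ᵐ y ∂(μ.map Y), ∫ w, f (y, w) ∂(noiseLaw PX C T) ≤
      Xbar * γbar * C ^ 2 / √(T : ℝ) := by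
    filter_upwards [hint'.prod_right_ae] with y hy
    rw [noiseLaw] at hy ⊢
    rw [integral_prod _ hy]
    have h1 := integral_mono_ae hy.integral_prod_left
      (integrable_const (Xbar * γbar * C ^ 2 / √(T : ℝ))) (by
        filter_upwards [h𝒳, hy.prod_right_ae] with x hx hyx
        rw [integral_prod _ hyx]
        have h2 := integral_perturbation_loss_le hθ (hX x hx) (alg (List.ofFn y) x) C T
        simpa [hf] using h2)
    simpa using h1
  have h1 := integral_mono_ae hint'.integral_prod_left
    (integrable_const (Xbar * γbar * C ^ 2 / √(T : ℝ))) hinner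
  simpa using h1

/-- One logarithm comes from `log n ≤ log T` in the numerator, the other from the harmonic sum.
Period 0, with no data, is bounded by `g`; since `D` and `1 + log T` are at least 1, lower-order
terms are absorbed. -/
theorem sum_posterior_bound_le {E : ℕ → ℝ} {g D M c₁ : ℝ} (hc₁ : 0 < c₁) (hD : 1 ≤ D)
    (hM : 0 ≤ M) (hg : 0 ≤ g) (hT : 1 ≤ T) (h0 : E 0 ≤ g)
    (hE : ∀ n, 1 ≤ n → E n ≤ (2 * D * Real.log n + M) / (n * (c₁ / √(T : ℝ)))) :
    ∑ n ∈ Finset.range T, E n ≤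
      (g + (2 + M) / c₁) * (D * √(T : ℝ) * (1 + Real.log T) ^ 2) := by
  obtain ⟨S, rfl⟩ : ∃ S, T = S + 1 := ⟨T - 1, by omega⟩
  set T := S + 1 with hTS
  have hT1 : (1 : ℝ) ≤ T := by exact_mod_cast hT
  have hsq : 1 ≤ √(T : ℝ) := Real.one_le_sqrt.2 hT1
  have hlog : 0 ≤ Real.log T := Real.log_nonneg hT1
  set L := 1 + Real.log T with hL
  have hL1 : 1 ≤ L := by linarith
  have hterm : ∀ n ∈ Finset.range S,
      E (n + 1) ≤ (2 + M) * D * L * √(T : ℝ) / c₁ * ((n + 1 : ℝ))⁻¹ := by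
    intro n hn
    have hnT : ((n + 1 : ℕ) : ℝ) ≤ T := by
      have := Finset.mem_range.1 hn
      exact_mod_cast (by omega : n + 1 ≤ T)
    have h1 : Real.log ((n + 1 : ℕ) : ℝ) ≤ Real.log T :=
      Real.log_le_log (by positivity) hnT
    have h2 : 2 * D * Real.log ((n + 1 : ℕ) : ℝ) + M ≤ (2 + M) * D * L := by
      have h3 : 2 * D * Real.log ((n + 1 : ℕ) : ℝ) ≤ 2 * D * L := by
        gcongr
        linarith
      have h4 : M * 1 ≤ M * (D * L) := by
        gcongr
        exact one_le_mul_of_one_le_of_one_le hD hL1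
      linarith
    refine (hE (n + 1) (by omega)).trans ?_
    calc _ ≤ (2 + M) * D * L / (((n + 1 : ℕ) : ℝ) * (c₁ / √(T : ℝ))) := by gcongr
      _ = _ := by
        push_cast
        field_simp
  have hharm : ∑ n ∈ Finset.range S, ((n + 1 : ℝ))⁻¹ ≤ L := by
    have h1 : ∑ n ∈ Finset.range S, ((n + 1 : ℝ))⁻¹ ≤ ∑ n ∈ Finset.range T, ((n + 1 : ℝ))⁻¹ :=
      Finset.sum_le_sum_of_subset_of_nonneg (Finset.range_mono (by omega))
        fun i _ _ => by positivity
    have h2 := harmonic_le_one_add_log T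
    rw [harmonic] at h2
    push_cast at h2
    exact h1.trans h2
  rw [Finset.sum_range_succ']
  have h1 : ∑ n ∈ Finset.range S, E (n + 1) ≤ (2 + M) * D * L * √(T : ℝ) / c₁ * L := by
    refine (Finset.sum_le_sum hterm).trans ?_
    rw [← Finset.mul_sum]
    gcongr
  have h2 : g * 1 ≤ g * (D * √(T : ℝ) * L ^ 2) := by
    gcongr
    exact one_le_mul_of_one_le_of_one_le (one_le_mul_of_one_le_of_one_le hD hsq)
      (one_le_pow₀ hL1)
  calc _ ≤ (2 + M) * D * L * √(T : ℝ) / c₁ * L + g * (D * √(T : ℝ) * L ^ 2) := by linarith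
    _ = _ := by ring

/-- The regret of a perturbed posterior average. -/
theorem IsDrivingNoise.regret_le (hW : IsDrivingNoise μ PX C T X ε δ)
    (hC : 0 < C) (hd : 1 ≤ d) (hT : 1 ≤ T) (hlo : 0 < lo) (h : lo ≤ hi) (hb : 0 < b)
    (hXbar : 0 < Xbar) (hγbar : 0 < γbar) (hX : ∀ x ∈ 𝒳, ‖x‖ ≤ Xbar) (h𝒳 : ∀ᵐ x ∂PX, x ∈ 𝒳)
    (hlam : ∀ u : Ctx d, lam * ‖u‖ ^ 2 ≤ ∫ x, (inner ℝ u x) ^ 2 ∂PX) (hlam0 : 0 < lam)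
    (hconv : Convex ℝ Γ) (hmeas : MeasurableSet Γ) [IsProbabilityMeasure (uniformPrior Γ)]
    (hΓ : ∀ γ ∈ Γ, ‖γ‖ ≤ γbar) (hslope : ∀ γ ∈ Γ, ∀ x ∈ 𝒳, inner ℝ (slopePart γ) x ≤ -b)
    {θ : Env d} (hθ : θ ∈ Γ) {B c₁ Cr : ℝ} (hB : B = Xbar * (1 + (hi + C)) * (2 * γbar))
    (hc₁ : c₁ = C ^ 2 / (2 * C ^ 2 + 2 * hi ^ 2 + 1) * lam / (8 + B ^ 2))
    (hCr : Cr = (Xbar * (1 + 2 * hi)) ^ 2 / (4 * b)) :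
    Integrable (fun ω => realizedRegret lo hi (algStar lo hi (uniformPrior Γ)) θ T
        (fun n => X n ω) (fun n => ε n ω) (fun n => δ n ω)) μ ∧
      regret μ lo hi (algStar lo hi (uniformPrior Γ)) θ T X ε δ ≤
        (Cr * ((2 * γbar) ^ 2 +
          (2 + (2 * B * ∫ e, |e| ∂(gaussianReal 0 1) + B ^ 2)) / c₁) + Xbar * γbar * C ^ 2) *
          d * √(T : ℝ) * (1 + Real.log T) ^ 2 := by
  set π := uniformPrior Γ with hπ
  have hπΓ : ∀ᵐ γ ∂π, γ ∈ Γ := ae_cond_mem hmeas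
  set alg := algStar lo hi π with halgdef
  have halg : ∀ n, Measurable fun p : (Fin n → Record d) × Ctx d => alg (List.ofFn p.1) p.2 :=
    measurable_algStar_ofFn h
  have halgI : ∀ l x, alg l x ∈ Icc lo hi := algStar_mem_Icc h
  have hB0 : 0 ≤ B := by rw [hB]; have := hlo.trans_le h; positivity
  have hc₁0 : 0 < c₁ := by rw [hc₁]; positivity
  have hCr0 : 0 ≤ Cr := by rw [hCr]; positivity
  set M := 2 * B * ∫ e, |e| ∂(gaussianReal 0 1) + B ^ 2 with hM
  have hM0 : 0 ≤ M := by
    have : 0 ≤ ∫ e, |e| ∂(gaussianReal 0 1) := integral_nonneg fun e => abs_nonneg e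
    positivity
  set Q : ℕ → Ω → ℝ := fun n ω =>
    ∫ γ, ‖θ - γ‖ ^ 2 ∂(posterior π (past alg θ (X · ω) (ε · ω) (δ · ω) n)) with hQ
  have hQmem : ∀ n ω, Q n ω ∈ Icc 0 ((2 * γbar) ^ 2) := fun n ω =>
    integral_posterior_sq_dist_mem hπΓ hΓ hθ _
  have hQint : ∀ n, Integrable (Q n) μ := fun n =>
    Integrable.of_mem_Icc 0 ((2 * γbar) ^ 2)
      (hW.measurable_integral_posterior_past halg θ n).aemeasurable
      (Filter.Eventually.of_forall (hQmem n))
  have hQ0 : ∫ ω, Q 0 ω ∂μ ≤ (2 * γbar) ^ 2 := by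
    have h1 := integral_mono (hQint 0) (integrable_const ((2 * γbar) ^ 2)) fun ω => (hQmem 0 ω).2
    simpa using h1
  have hQn : ∀ n, 1 ≤ n →
      ∫ ω, Q n ω ∂μ ≤ (2 * d * Real.log n + M) / (n * (c₁ / √(T : ℝ))) := fun n hn => by
    refine hW.integral_posterior_sq_dist_le halg halgI hC hT hlo hX h𝒳 hlam hlam0 hconv hmeas hΓ
      hθ hB ?_ hn
    -- The information rate per period is `c₁ / √T`, as the squared perturbation is `C ^ 2 / √T`.
    rw [perturbationSize_sq, hc₁]
    ring
  -- The regret of a period is split at the unperturbed price: `loss` is the cost of exploration,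
  -- `gap` that of posterior averaging.
  set loss : ℕ → Ω → ℝ := fun n ω =>
    expectedRevenue θ (X n ω) (alg (past alg θ (X · ω) (ε · ω) (δ · ω) n) (X n ω)) -
      expectedRevenue θ (X n ω) (postedPrice alg θ (X · ω) (ε · ω) (δ · ω) n) with hloss
  set gap : ℕ → Ω → ℝ := fun n ω =>
    expectedRevenue θ (X n ω) (optPrice lo hi θ (X n ω)) -
      expectedRevenue θ (X n ω) (alg (past alg θ (X · ω) (ε · ω) (δ · ω) n) (X n ω)) with hgap
  have hlossB : ∀ n, Integrable (loss n) μ ∧ ∫ ω, loss n ω ∂μ ≤ Xbar * γbar * C ^ 2 / √(T : ℝ) :=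
    fun n => hW.integral_exploration_loss_le halg halgI hC hT hlo hX h𝒳 (hΓ θ hθ) n
  have hgapm : ∀ n, Measurable (gap n) := fun n => by
    have h1 : Measurable fun ω => (θ, X n ω) := measurable_const.prodMk (hW.measurable_X n)
    have h2 : Measurable fun ω => optPrice lo hi θ (X n ω) := ((measurable_optPrice h).comp h1 :)
    have h3 : Measurable fun ω => (θ, X n ω, optPrice lo hi θ (X n ω)) :=
      measurable_const.prodMk ((hW.measurable_X n).prodMk h2)
    have h4 : Measurable fun ω =>
        (θ, X n ω, alg (past alg θ (X · ω) (ε · ω) (δ · ω) n) (X n ω)) :=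
      measurable_const.prodMk ((hW.measurable_X n).prodMk (hW.measurable_alg_past halg θ n))
    exact (measurable_expectedRevenue.comp h3 :).sub (measurable_expectedRevenue.comp h4 :)
  have hgapQ : ∀ n, ∀ᵐ ω ∂μ, 0 ≤ gap n ω ∧ gap n ω ≤ Cr * Q n ω := fun n => by
    filter_upwards [hW.ae_of_ae_noiseLaw (ae_noiseLaw h𝒳)] with ω hω
    refine ⟨sub_nonneg.2 ((optPrice_spec h θ (X n ω)).2 (halgI _ _)), ?_⟩
    rw [hCr]
    exact posterior_gap_le hlo h hπΓ hΓ hb (hX _ (hω n).1)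
      (fun γ hγ => hslope γ hγ _ (hω n).1) hθ _
  have hgapint : ∀ n, Integrable (gap n) μ := fun n => by
    refine ((hQint n).const_mul Cr).mono' (hgapm n).aestronglyMeasurable ?_
    filter_upwards [hgapQ n] with ω hω
    rw [Real.norm_eq_abs, abs_of_nonneg hω.1]
    exact hω.2
  have hgapB : ∀ n, ∫ ω, gap n ω ∂μ ≤ Cr * ∫ ω, Q n ω ∂μ := fun n => by
    rw [← integral_const_mul]
    exact integral_mono_ae (hgapint n) ((hQint n).const_mul Cr) ((hgapQ n).mono fun ω hω => hω.2)
  have hreal : (fun ω => realizedRegret lo hi alg θ T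
      (fun n => X n ω) (fun n => ε n ω) (fun n => δ n ω)) =
      fun ω => ∑ n ∈ Finset.range T, (gap n ω + loss n ω) := by
    funext ω
    refine Finset.sum_congr rfl fun n _ => ?_
    simp only [hgap, hloss]
    ring
  have hsum : ∀ n ∈ Finset.range T, Integrable (fun ω => gap n ω + loss n ω) μ := fun n _ =>
    (hgapint n).add (hlossB n).1
  refine ⟨hreal ▸ integrable_finsetSum _ hsum, ?_⟩
  have hT1 : (1 : ℝ) ≤ T := by exact_mod_cast hT
  have hd1 : (1 : ℝ) ≤ d := by exact_mod_cast hd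
  have hlog : 0 ≤ Real.log T := Real.log_nonneg hT1
  have hper : ∀ n ∈ Finset.range T, ∫ ω, (gap n ω + loss n ω) ∂μ ≤
      Cr * ∫ ω, Q n ω ∂μ + Xbar * γbar * C ^ 2 / √(T : ℝ) := fun n _ => by
    rw [integral_add (hgapint n) (hlossB n).1]
    exact add_le_add (hgapB n) (hlossB n).2
  have hQsum := sum_posterior_bound_le (E := fun n => ∫ ω, Q n ω ∂μ) hc₁0 hd1 hM0
    (by positivity : (0 : ℝ) ≤ (2 * γbar) ^ 2) hT hQ0 hQn
  have hexp : T * (Xbar * γbar * C ^ 2 / √(T : ℝ)) = Xbar * γbar * C ^ 2 * √(T : ℝ) := by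
    rw [mul_div_assoc', mul_comm (T : ℝ), mul_div_assoc, Real.div_sqrt]
  have hexp2 : Xbar * γbar * C ^ 2 * √(T : ℝ) ≤
      Xbar * γbar * C ^ 2 * (d * √(T : ℝ) * (1 + Real.log T) ^ 2) := by
    have h1 : 1 * √(T : ℝ) * 1 ≤ d * √(T : ℝ) * (1 + Real.log T) ^ 2 := by
      gcongr
      exact one_le_pow₀ (by linarith)
    gcongr
    linarith
  rw [regret, hreal, integral_finsetSum _ hsum]
  calc _ ≤ ∑ n ∈ Finset.range T,
        (Cr * ∫ ω, Q n ω ∂μ + Xbar * γbar * C ^ 2 / √(T : ℝ)) := Finset.sum_le_sum hper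
    _ = Cr * ∑ n ∈ Finset.range T, ∫ ω, Q n ω ∂μ + Xbar * γbar * C ^ 2 * √(T : ℝ) := by
        rw [Finset.sum_add_distrib, ← Finset.mul_sum, Finset.sum_const, Finset.card_range,
          nsmul_eq_mul, hexp]
    _ ≤ Cr * (((2 * γbar) ^ 2 + (2 + M) / c₁) * (d * √(T : ℝ) * (1 + Real.log T) ^ 2)) +
        Xbar * γbar * C ^ 2 * (d * √(T : ℝ) * (1 + Real.log T) ^ 2) := by gcongr
    _ = _ := by ring

end ContextualPricing

/-! ### Choice of the constants and assembly of the claims -/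

theorem mainTheorem7
    (γbar Xbar lo hi b lam C : ℝ) (hγbar : 0 < γbar) (hXbar : 0 < Xbar)
    (hlo : 0 < lo) (hlohi : lo ≤ hi) (hb : 0 < b) (hlam : 0 < lam) (hC : 0 < C) :
    ∃ rbar CΓ Cr K : ℝ, 0 < CΓ ∧ 0 < Cr ∧ 0 < K ∧
      ∀ (d T : ℕ), 1 ≤ d → 1 ≤ T →
      -- contexts: bounded, with a uniformly positive definite second-moment matrix
      ∀ (𝒳 : Set (Ctx d)) (PX : Measure (Ctx d)), IsProbabilityMeasure PX →
      (∀ x ∈ 𝒳, ‖x‖ ≤ Xbar) → (∀ᵐ x ∂PX, x ∈ 𝒳) →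
      (∀ u : Ctx d, lam * ‖u‖ ^ 2 ≤ ∫ x, (inner ℝ u x) ^ 2 ∂PX) →
      -- environments: a bounded convex body of demand curves that decrease in the price
      ∀ Γ : Set (Env d), Convex ℝ Γ → MeasurableSet Γ → volume Γ ≠ 0 →
      (∀ γ ∈ Γ, ‖γ‖ ≤ γbar) →
      (∀ γ ∈ Γ, ∀ x ∈ 𝒳, inner ℝ (slopePart γ) x ≤ -b) →
      EnvironmentAssumption Γ (uniformPrior Γ) 𝒳
          (Set.Icc (lo - perturbationSize C T) (hi + perturbationSize C T)) γbar rbar ∧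
      ObservationAssumption Γ 𝒳
          (Set.Icc (lo - perturbationSize C T) (hi + perturbationSize C T))
          infoMatrix (√2) CΓ ∧
      RewardGapAssumption Γ (uniformPrior Γ) 𝒳 lo hi C T
          (Xbar * γbar * C ^ 2 / √(T : ℝ)) Cr ∧
      ∀ (Ω : Type*) [MeasurableSpace Ω] (μ : Measure Ω), IsProbabilityMeasure μ →
      ∀ (X : ℕ → Ω → Ctx d) (ε δ : ℕ → Ω → ℝ), IsDrivingNoise μ PX C T X ε δ →
      ∀ γ ∈ Γ,
        Integrable (fun ω => realizedRegret lo hi (algStar lo hi (uniformPrior Γ)) γ T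
          (fun n => X n ω) (fun n => ε n ω) (fun n => δ n ω)) μ ∧
        regret μ lo hi (algStar lo hi (uniformPrior Γ)) γ T X ε δ ≤
          K * d * √(T : ℝ) * (1 + Real.log T) ^ 2 := by
  -- `B` bounds the difference of mean demands of two environments in `Γ`: prices are at most `hi +
  -- C` in absolute value, as `T ≥ 1`, and `Γ` has diameter at most `2 * γbar`. None of the
  -- constants involves `d`, `T` or the shape of `Γ`.
  set B := Xbar * (1 + (hi + C)) * (2 * γbar) with hB
  set c₁ := C ^ 2 / (2 * C ^ 2 + 2 * hi ^ 2 + 1) * lam / (8 + B ^ 2) with hc₁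
  set Cr := (Xbar * (1 + 2 * hi)) ^ 2 / (4 * b) with hCr
  have hhi : 0 < hi := hlo.trans_le hlohi
  have hm : 0 ≤ ∫ e, |e| ∂(gaussianReal 0 1) := integral_nonneg fun e => abs_nonneg e
  have hB0 : 0 < B := by positivity
  have hc₁0 : 0 < c₁ := by positivity
  have hCr0 : 0 < Cr := by positivity
  refine ⟨Xbar * (1 + (hi + C)) * γbar * (hi + C), ((Xbar * (1 + (hi + C))) ^ 2) ^ 2, Cr,
    Cr * ((2 * γbar) ^ 2 + (2 + (2 * B * ∫ e, |e| ∂(gaussianReal 0 1) + B ^ 2)) / c₁) +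
      Xbar * γbar * C ^ 2, by positivity, hCr0, by positivity, ?_⟩
  intro d T hd hT 𝒳 PX hPX hX h𝒳 hlam' Γ hconv hmeas h0 hΓ hslope
  have hprob := isProbabilityMeasure_uniformPrior h0 hΓ
  refine ⟨environmentAssumption hC hT hlo hlohi hX h0 hΓ,
    observationAssumption hC hT hlo hlohi hX hconv,
    rewardGapAssumption hlo hlohi hb hX hmeas hΓ hslope C T, ?_⟩
  intro Ω _ μ hμ X ε δ hW γ hγ
  exact hW.regret_le hC hd hT hlo hlohi hb hXbar hγbar hX h𝒳 hlam' hlam hconv hmeas hΓ hslope hγ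
    hB hc₁ hCr
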